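/- **Corollary 5.3 (Poisson batch sizes).** Consider an open network of $J$ infinite server queues. Batches of customers arrive at the points $T_1, T_2, \dots$ of a non-homogeneous Poisson process on $[0,\infty)$ with locally integrable rate $\lambda(t) \ge 0$. The $i$-th batch brings $\Sigma_{ij}$ customers to queue $j$, where the vectors $\mathbf{\Sigma}_i = (\Sigma_{i1}, \dots, \Sigma_{iJ})$ are i.i.d. The $\ell$-th customer who enters queue $j$ with the $i$-th batch follows a (measurable) stochastic process $X^j_{i,\ell}(s)$, $s \ge 0$, where $X^j_{i,\ell}(s) = k$ if the customer is in queue $k \in \{1,\dots,J\}$ at time $T_i + s$; a customer may also have left the network. We have $P(X^j_{i,\ell}(s) = k) = q^j_k(s)$, so that $\sum_{k=1}^J q^j_k(s) \le 1$. The arrival times, the batch vectors and all the customer processes are independent. Let $N_k(t)$ be the number of customers in queue $k$ at time $t \ge 0$ among the batches that arrived in $[0,t)$, and $\mathbf{N}(t) = (N_1(t), \dots, N_J(t))$. Suppose that the batches are univariate with i.i.d. entry queues and Poisson size: there are $p_j \ge 0$ with $\sum_{j=1}^J p_j = 1$ and $S \sim \mathrm{Poisson}(\mu)$, $\mu \ge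 0$, such that $$E\Big[\prod_{j=1}^J z_j^{\Sigma_{ij}}\Big] = G_S\Big(\sum_{j=1}^J p_j z_j\Big) \quad \text{for all complex } |z_j| \le 1, \qquad G_S(w) = E[w^S].$$ Put $q_k(s) = \sum_{j=1}^J p_j\, q^j_k(s)$. Then for every $t \ge 0$, every $v \in \{1, \dots, J\}$ and all non-negative integers $n_1, \dots, n_v$ with $n_v \ge 1$, $$P\big[\mathbf{N}(t) = (n_1, \dots, n_v, 0, \dots, 0)\big] = \sum_{i_1=0}^{n_1} \cdots \sum_{i_{v-1}=0}^{n_{v-1}} \sum_{i_v=1}^{n_v} \Bigg[ \frac{i_v}{n_v}\, P\big[\mathbf{N}(t) = (n_1 - i_1, \dots, n_v - i_v, 0, \dots, 0)\big] \int_0^t \lambda(\tau) \bigg[\prod_{k=1}^v \frac{(q_k(t-\tau)\mu)^{i_k}}{i_k!}\bigg] e^{-\mu \sum_{k=1}^J q_k(t-\tau)}\, d\tau \Bigg],$$ where all the integrals exist. In particular, if $\sum_{k=1}^J q_k(s) = 1$ for all $s \in [0,t]$ (every customer is always located in one of the $J$ queues), the recurrence holds with the kernel $$\int_0^t \lambda(\tau)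 \bigg[\prod_{k=1}^v \frac{(q_k(t-\tau)\mu)^{i_k}}{i_k!}\bigg] e^{-\mu}\, d\tau .$$ -/

import Mathlib

open MeasureTheory ProbabilityTheory
open scoped ENNReal NNReal

/-- Number of points of the sequence `T` lying in `B`. The value `⊤` of `T i` means that there is
no `i`-th point, so that sequences with finitely many points are covered. -/
noncomputable def pointCount {Ω : Type*} (T : ℕ → Ω → ℝ≥0∞) (B : Set ℝ) (ω : Ω) : ℕ∞ :=
  {i : ℕ | T i ω ≠ ⊤ ∧ (T i ω).toReal ∈ B}.encard

/-- `T` enumerates the points of a (non-homogeneous) Poisson process on `[0, ∞)` with rate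
function `rate`: the number of points in `B` is Poisson with mean `∫_B rate` whenever this is
finite, and the numbers of points in disjoint sets are independent. The order of the
enumeration is irrelevant. -/
structure IsPoissonProcess {Ω : Type*} [MeasurableSpace Ω] (P : Measure Ω) (rate : ℝ → ℝ)
    (T : ℕ → Ω → ℝ≥0∞) : Prop where
  measurable_point : ∀ i, Measurable (T i)
  count_law : ∀ (B : Set ℝ) (m : ℝ≥0), MeasurableSet B → B ⊆ Set.Ici 0 →
    ∫⁻ s in B, ENNReal.ofReal (rate s) = m →
    HasLaw (pointCount T B) ((poissonMeasure m).map (fun n : ℕ => (n : ℕ∞))) P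
  count_indep : ∀ (r : ℕ) (B : Fin r → Set ℝ), (∀ l, MeasurableSet (B l)) →
    (∀ l, B l ⊆ Set.Ici 0) → (∀ l l', l ≠ l' → Disjoint (B l) (B l')) →
    iIndepFun (fun l => pointCount T (B l)) P

/-- The random ingredients of an open network of `J` infinite server queues with multivariate
batch arrivals:
* `arrival i`: the time at which the `i`-th batch arrives;
* `batch i ω j`: the number of customers of the `i`-th batch that enter at queue `j`;
* `location i j l s`: where the `l`-th of these customers is, a time `s ≥ 0` after the arrival of
  its batch: `some k` is queue `k`, and `none` means that it has left the network. Only the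
  customers `l < batch i ω j` exist. -/
structure BatchNetwork (Ω : Type*) (J : ℕ) where
  arrival : ℕ → Ω → ℝ≥0∞
  batch : ℕ → Ω → Fin J → ℕ
  location : ℕ → Fin J → ℕ → ℝ → Ω → Option (Fin J)

/-- Index set of the independent sources of randomness in a network. -/
inductive BatchNetwork.Source (J : ℕ) where
  | arrivals : BatchNetwork.Source J
  | batch (i : ℕ) : BatchNetwork.Source J
  | customer (i : ℕ) (j : Fin J) (l : ℕ) : BatchNetwork.Source J

/-- The σ-algebra generated by the process `s ↦ X s`, `s ≥ 0`, with values in a discrete space. -/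
@[reducible]
def routeSigma {Ω E : Type*} (X : ℝ → Ω → E) : MeasurableSpace Ω :=
  ⨆ s : Set.Ici (0 : ℝ), MeasurableSpace.comap (X s) ⊤

/-- The σ-algebras generated by, respectively, the sequence of arrival times, the size vector of
the `i`-th batch, and the route of the customer `(i, j, l)`. -/
@[reducible]
def BatchNetwork.sourceSigma {Ω : Type*} {J : ℕ} (N : BatchNetwork Ω J) :
    BatchNetwork.Source J → MeasurableSpace Ω
  | .arrivals => ⨆ i, MeasurableSpace.comap (N.arrival i) inferInstance
  | .batch i => MeasurableSpace.comap (N.batch i) inferInstance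
  | .customer i j l => routeSigma (N.location i j l)

/-- The number of customers that are in queue `k` at time `t`. -/
noncomputable def BatchNetwork.occupancy {Ω : Type*} {J : ℕ} (N : BatchNetwork Ω J) (t : ℝ)
    (k : Fin J) (ω : Ω) : ℕ∞ :=
  {c : ℕ × Fin J × ℕ | N.arrival c.1 ω < ENNReal.ofReal t ∧ c.2.2 < N.batch c.1 ω c.2.1 ∧
    N.location c.1 c.2.1 c.2.2 (t - (N.arrival c.1 ω).toReal) ω = some k}.encard

/-- The probability that the vector of queue lengths at time `t` is `n`. -/
noncomputable def BatchNetwork.occupancyProb {Ω : Type*} [MeasurableSpace Ω] {J : ℕ}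
    (N : BatchNetwork Ω J) (P : Measure Ω) (t : ℝ) (n : Fin J → ℕ) : ℝ :=
  P.real {ω | ∀ k, N.occupancy t k ω = (n k : ℕ∞)}

/-- The standing model assumptions: batches arrive at the points of a Poisson process with rate
function `rate`; the batch size vectors are identically distributed; a customer who entered at
queue `j` is in queue `k`, a time `s` after its arrival, with probability `q j k s`; the arrival
times, the batch size vectors and the routes of all the customers are independent. The location
process of a customer is a measurable process (with respect to the σ-algebra that it generates),
as is every process with right-continuous paths. -/
structure BatchNetwork.IsModel {Ω : Type*} [MeasurableSpace Ω] {J : ℕ} (N : BatchNetwork Ω J)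
    (P : Measure Ω) (rate : ℝ → ℝ) (q : Fin J → Fin J → ℝ → ℝ) : Prop where
  isPoissonProcess : IsPoissonProcess P rate N.arrival
  measurable_batch : ∀ i, Measurable (N.batch i)
  identDistrib_batch : ∀ i, IdentDistrib (N.batch i) (N.batch 0) P P
  measurable_location : ∀ i j l s, 0 ≤ s → ∀ k, MeasurableSet {ω | N.location i j l s ω = some k}
  jointly_measurable_location : ∀ i j l k,
    @MeasurableSet (Set.Ici (0 : ℝ) × Ω)
      (@Prod.instMeasurableSpace _ _ inferInstance (routeSigma (N.location i j l)))
      {x | N.location i j l x.1 x.2 = some k}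
  location_law : ∀ i j l s, 0 ≤ s → ∀ k, P.real {ω | N.location i j l s ω = some k} = q j k s
  indep : iIndep N.sourceSigma P

/-- Probability generating function of a random vector `S` with values in `ℕ^J`. -/
noncomputable def vectorPGF {Ω : Type*} [MeasurableSpace Ω] {J : ℕ} (P : Measure Ω)
    (S : Ω → Fin J → ℕ) (z : Fin J → ℂ) : ℂ :=
  ∫ ω, ∏ j, z j ^ S ω j ∂P

/-- Probability generating function of a distribution `ν` on `ℕ`. -/
noncomputable def scalarPGF (ν : Measure ℕ) (w : ℂ) : ℂ :=
  ∫ n, w ^ n ∂ν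

/-- The batches of the network are univariate with size distribution `ν`, each customer being
assigned independently to the entry queue `j` with probability `p j`. -/
structure BatchNetwork.HasUnivariateBatches {Ω : Type*} [MeasurableSpace Ω] {J : ℕ}
    (N : BatchNetwork Ω J) (P : Measure Ω) (ν : Measure ℕ) (p : Fin J → ℝ) : Prop where
  nonneg : ∀ j, 0 ≤ p j
  sum_eq_one : ∑ j, p j = 1
  pgf_eq : ∀ (i : ℕ) (z : Fin J → ℂ), (∀ j, ‖z j‖ ≤ 1) →
    vectorPGF P (N.batch i) z = scalarPGF ν (∑ j, (p j : ℂ) * z j)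

/-- The probability that a customer is in queue `k` a time `s` after its arrival. -/
def mixedLocation {J : ℕ} (p : Fin J → ℝ) (q : Fin J → Fin J → ℝ → ℝ) (k : Fin J) (s : ℝ) : ℝ :=
  ∑ j, p j * q j k s

/-! ### Multivariate power series with summable coefficients -/

/-! The vector of queue lengths is compound Poisson, and the recurrence is the logarithmic
derivative of its generating function read off coefficientwise.

Fix `z` in the unit cube. Given the arrival times and batch sizes, the customers move independently,
so one who entered queue `j` at time `τ` contributes the mean factor `1 + ∑ k, q j k (t - τ) * (z k
- 1)`. Averaging over a Poisson batch with random entry queues (Poisson thinning) turns the product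
of these factors into `exp (∑ k, x k * (z k - 1))`, where `x k = μ * q_k (t - τ)`. The generating
functional of the Poisson process then gives the generating function of the queue lengths, `exp (-∫
(1 - exp (∑ k, x k * (z k - 1))))`, with the integral taken against the intensity on `[0, t)`
(`integral_prod_pow_queueLengths`). The two averagings are instances of
`integral_prod_eq_of_iIndep`, applied to finite boxes of potential customers that almost surely end
up containing every real one.

The inner exponential generates a product of Poisson laws, so the exponent is a power series `∑ c i
* z ^ i` minus a constant, with `c i` the integrated Poisson mass. If `A = exp (c - C)`, then `z_v
∂_v A = (z_v ∂_v c) * A`; comparing coefficients gives `n_v a_n = ∑ i_v c_i a_{n-i}`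
(`coeff_recurrence_of_tsum_eq_exp`). Division by `n_v` and removal of the terms with `i_v = 0` yield
the claim.

The constant coefficient is isolated by letting `x` tend to `0` from the right; the value at `1 / 2`
supplies the bound for uniform convergence on `[0, 1/2]`. -/

lemma coeff_zero_eq_zero_of_hasSum_zero {b : ℕ → ℝ}
    (h : ∀ x ∈ Set.Ioo (0 : ℝ) 1, HasSum (fun n => b n * x ^ n) 0) : b 0 = 0 := by
  have hs : Summable fun n => |b n * (1 / 2 : ℝ) ^ n| :=
    (h (1 / 2) ⟨by norm_num, by norm_num⟩).summable.abs
  have hc : ContinuousOn (fun x : ℝ => ∑' n, b n * x ^ n) (Set.Icc 0 (1 / 2)) := by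
    refine continuousOn_tsum (fun n => by fun_prop) hs fun n x hx => ?_
    rw [Real.norm_eq_abs, abs_mul, abs_mul, abs_pow, abs_pow, abs_of_nonneg hx.1,
      abs_of_pos (by norm_num : (0 : ℝ) < 1 / 2)]
    exact mul_le_mul_of_nonneg_left (pow_le_pow_left₀ hx.1 hx.2 n) (abs_nonneg _)
  have h0 : ∑' n, b n * (0 : ℝ) ^ n = b 0 := by
    rw [tsum_eq_single 0 (fun n hn => by simp [hn])]; simp
  have hl : Filter.Tendsto (fun x : ℝ => ∑' n, b n * x ^ n) (nhdsWithin 0 (Set.Ioo 0 (1 / 2)))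
      (nhds (b 0)) := by
    rw [← h0]
    exact ((hc 0 ⟨le_rfl, by norm_num⟩).mono Set.Ioo_subset_Icc_self)
  have hl' : Filter.Tendsto (fun x : ℝ => ∑' n, b n * x ^ n)
      (nhdsWithin 0 (Set.Ioo 0 (1 / 2))) (nhds 0) := by
    refine tendsto_const_nhds.congr' ?_
    filter_upwards [self_mem_nhdsWithin] with x hx
    exact (h x ⟨hx.1, hx.2.trans (by norm_num)⟩).tsum_eq.symm
  have : (nhdsWithin (0 : ℝ) (Set.Ioo 0 (1 / 2))).NeBot := left_nhdsWithin_Ioo_neBot (by norm_num)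
  exact tendsto_nhds_unique hl hl'

/-- Once the constant coefficient vanishes, the series can be divided by `x > 0`, and the shifted
series satisfies the same hypothesis. -/
lemma eq_zero_of_hasSum_pow_zero {b : ℕ → ℝ}
    (h : ∀ x ∈ Set.Ioo (0 : ℝ) 1, HasSum (fun n => b n * x ^ n) 0) : b = 0 := by
  have key : ∀ k, ∀ x ∈ Set.Ioo (0 : ℝ) 1, HasSum (fun n => b (n + k) * x ^ n) 0 := by
    intro k
    induction k with
    | zero => simpa using h
    | succ k ih =>
      intro x hx
      have h0 : b (0 + k) = 0 := coeff_zero_eq_zero_of_hasSum_zero (b := fun n => b (n + k)) ih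
      have h1 := (hasSum_nat_add_iff' 1).2 (ih x hx)
      simp only [Finset.range_one, Finset.sum_singleton, h0, zero_mul, sub_zero] at h1
      have h2 := h1.mul_right x⁻¹
      rw [zero_mul] at h2
      refine h2.congr_fun fun n => ?_
      rw [add_assoc n 1 k, add_comm 1 k, pow_succ, mul_assoc, mul_assoc,
        mul_inv_cancel₀ hx.1.ne', mul_one]
  funext k
  have := coeff_zero_eq_zero_of_hasSum_zero (b := fun n => b (n + k)) (key k)
  simpa using this

/-- Induction on the number of variables: with the other variables fixed, the sums over them are the
coefficients of a vanishing series in the first variable, hence are themselves zero. -/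
lemma eq_zero_of_hasSum_monomial_zero {J : ℕ} {a : (Fin J → ℕ) → ℝ}
    (h : ∀ z : Fin J → ℝ, (∀ k, z k ∈ Set.Ioo (0 : ℝ) 1) →
      HasSum (fun n => a n * ∏ k, z k ^ n k) 0) : a = 0 := by
  induction J with
  | zero =>
    funext n
    have h1 := h (fun _ => 0) (fun k => k.elim0)
    have h2 := hasSum_fintype (fun n : Fin 0 → ℕ => a n * ∏ k, ((fun _ => 0) k : ℝ) ^ n k)
    have := h1.unique h2
    simp only [Finset.univ_unique, Finset.univ_eq_empty, Finset.prod_empty, mul_one,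
      Finset.sum_singleton] at this
    exact Eq.trans (congrArg a (Subsingleton.elim _ _)) this.symm
  | succ J ih =>
    have hz : ∀ (x : ℝ) (z : Fin J → ℝ), x ∈ Set.Ioo (0 : ℝ) 1 → (∀ k, z k ∈ Set.Ioo (0 : ℝ) 1) →
        HasSum (fun y : ℕ × (Fin J → ℕ) => (a (Fin.cons y.1 y.2) * ∏ k, z k ^ y.2 k) * x ^ y.1)
          0 := by
      intro x z hx hz
      have h1 := h (Fin.cons x z) (fun k => by
        refine Fin.cases ?_ (fun k => ?_) k
        · simpa using hx
        · simpa using hz k)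
      have h2 := (Equiv.hasSum_iff (Fin.consEquiv (fun _ : Fin (J + 1) => ℕ))).2 h1
      refine h2.congr_fun fun y => ?_
      simp [Fin.prod_univ_succ, Fin.consEquiv]
      ring
    have hfix : ∀ z : Fin J → ℝ, (∀ k, z k ∈ Set.Ioo (0 : ℝ) 1) →
        ∀ m, HasSum (fun n => a (Fin.cons m n) * ∏ k, z k ^ n k) 0 := by
      intro z hz'
      have hsum : ∀ m, Summable (fun n => a (Fin.cons m n) * ∏ k, z k ^ n k) := by
        intro m
        -- Any nonzero value of the first variable would do; its power is divided out of the fibre.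
        have h1 := (hz (1 / 2) z ⟨by norm_num, by norm_num⟩ hz').summable.prod_factor m
        have h2 : ((1 / 2 : ℝ) ^ m) ≠ 0 := by positivity
        exact (summable_mul_right_iff h2).1 h1
      have h0 : (fun m => ∑' n, a (Fin.cons m n) * ∏ k, z k ^ n k) = 0 := by
        refine eq_zero_of_hasSum_pow_zero fun x hx => ?_
        exact HasSum.prod_fiberwise (hz x z hx hz') fun m => (hsum m).hasSum.mul_right (x ^ m)
      intro m
      have := (hsum m).hasSum
      rwa [show ∑' n, a (Fin.cons m n) * ∏ k, z k ^ n k = 0 from congrFun h0 m] at this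
    funext n
    have := ih (a := fun n' => a (Fin.cons (n 0) n')) fun z hz' => hfix z hz' (n 0)
    have := congrFun this (Fin.tail n)
    simpa using this

/-! ### Termwise differentiation, Cauchy products and the coefficient recurrence -/

lemma exists_bound_nat_mul_pow {r : ℝ} (h0 : 0 < r) (h1 : r < 1) :
    ∃ B, ∀ n : ℕ, n * r ^ (n - 1) ≤ B := by
  obtain ⟨B, hB⟩ := (tendsto_self_mul_const_pow_of_lt_one h0.le h1).bddAbove_range
  refine ⟨B / r, fun n => ?_⟩
  rw [le_div_iff₀ h0]
  refine le_trans (le_of_eq ?_) (hB ⟨n, rfl⟩)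
  rcases n with _ | n
  · simp
  · simp [pow_succ, mul_assoc]

lemma prod_pow_mem_Icc {ι : Type*} (s : Finset ι) {z : ι → ℝ} (hz : ∀ k, z k ∈ Set.Icc (0 : ℝ) 1)
    (n : ι → ℕ) : ∏ k ∈ s, z k ^ n k ∈ Set.Icc (0 : ℝ) 1 :=
  ⟨Finset.prod_nonneg fun k _ => pow_nonneg (hz k).1 _,
    Finset.prod_le_one (fun k _ => pow_nonneg (hz k).1 _) fun k _ => pow_le_one₀ (hz k).1 (hz k).2⟩

lemma summable_monomial {J : ℕ} {a : (Fin J → ℕ) → ℝ} (ha : Summable a)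
    {z : Fin J → ℝ} (hz : ∀ k, z k ∈ Set.Icc (0 : ℝ) 1) :
    Summable fun n => a n * ∏ k, z k ^ n k := by
  refine Summable.of_norm_bounded ha.abs fun n => ?_
  have := prod_pow_mem_Icc Finset.univ hz n
  rw [Real.norm_eq_abs, abs_mul, abs_of_nonneg this.1]
  exact mul_le_of_le_one_right (abs_nonneg _) this.2

lemma prod_update_pow {J : ℕ} (z : Fin J → ℝ) (v : Fin J) (x : ℝ) (n : Fin J → ℕ) :
    ∏ k, Function.update z v x k ^ n k = (∏ k ∈ Finset.univ.erase v, z k ^ n k) * x ^ n v := by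
  rw [← Finset.prod_erase_mul _ _ (Finset.mem_univ v), Function.update_self]
  congr 1
  refine Finset.prod_congr rfl fun k hk => ?_
  rw [Function.update_of_ne (Finset.ne_of_mem_erase hk)]

/-- For `y` below some `r < 1` the factors `m * y ^ (m - 1)` are bounded uniformly in `m`, so a
multiple of `|a n|` dominates the differentiated series. Dividing by `z v` expresses the derivative
through the Euler operator `z_v ∂_v`, which multiplies coefficients by `n v` without shifting
indices. -/
lemma summable_and_hasDerivAt_tsum_monomial {J : ℕ} {a : (Fin J → ℕ) → ℝ} (ha : Summable a)
    {z : Fin J → ℝ} (hz : ∀ k, z k ∈ Set.Ioo (0 : ℝ) 1) (v : Fin J) :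
    Summable (fun n => n v * a n * ∏ k, z k ^ n k) ∧
    HasDerivAt (fun x => ∑' n, a n * ∏ k, Function.update z v x k ^ n k)
      ((∑' n, n v * a n * ∏ k, z k ^ n k) / z v) (z v) := by
  have hz' : ∀ k, z k ∈ Set.Icc (0 : ℝ) 1 := fun k => Set.Ioo_subset_Icc_self (hz k)
  have hv := hz v
  set r := (z v + 1) / 2 with hr
  have hr0 : 0 < r := by linarith [hv.1]
  have hr1 : r < 1 := by linarith [hv.2]
  have hzr : z v < r := by linarith [hv.2]
  obtain ⟨B, hB⟩ := exists_bound_nat_mul_pow hr0 hr1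
  set C : (Fin J → ℕ) → ℝ := fun n => ∏ k ∈ Finset.univ.erase v, z k ^ n k
  have hC : ∀ n, C n ∈ Set.Icc (0 : ℝ) 1 := fun n => prod_pow_mem_Icc _ hz' n
  have hbd : ∀ n, ∀ y ∈ Set.Ioo 0 r, ‖a n * (C n * (n v * y ^ (n v - 1)))‖ ≤ |a n| * B := by
    intro n y hy
    have h1 : 0 ≤ (n v : ℝ) * y ^ (n v - 1) := by have := hy.1; positivity
    rw [Real.norm_eq_abs, abs_mul, abs_of_nonneg (mul_nonneg (hC n).1 h1)]
    refine mul_le_mul_of_nonneg_left ?_ (abs_nonneg _)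
    refine (mul_le_of_le_one_left h1 (hC n).2).trans (le_trans ?_ (hB (n v)))
    exact mul_le_mul_of_nonneg_left (pow_le_pow_left₀ hy.1.le hy.2.le _) (Nat.cast_nonneg _)
  have hterm : ∀ n : Fin J → ℕ, (n v * a n * ∏ k, z k ^ n k)
      = a n * (C n * (n v * z v ^ (n v - 1))) * z v := by
    intro n
    rw [← Finset.prod_erase_mul _ _ (Finset.mem_univ v)]
    change _ * (C n * _) = _
    rcases h : n v with _ | m
    · simp
    · rw [Nat.add_sub_cancel, pow_succ]; ring
  have hsum : Summable fun n => a n * (C n * (n v * z v ^ (n v - 1))) :=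
    Summable.of_norm_bounded (ha.abs.mul_right B) fun n => hbd n _ ⟨hv.1, hzr⟩
  refine ⟨by simpa only [hterm] using hsum.mul_right (z v), ?_⟩
  simp only [hterm, tsum_mul_right, mul_div_assoc, div_self hv.1.ne', mul_one]
  simp only [prod_update_pow]
  refine hasDerivAt_tsum_of_isPreconnected (ha.abs.mul_right B) isOpen_Ioo isPreconnected_Ioo
    (fun n y _ => ?_) hbd (show z v ∈ Set.Ioo 0 r from ⟨hv.1, hzr⟩) ?_ ⟨hv.1, hzr⟩
  · exact ((hasDerivAt_pow (n v) y).const_mul (C n)).const_mul (a n)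
  · have := summable_monomial ha hz'
    refine this.congr fun n => ?_
    rw [← Finset.prod_erase_mul _ _ (Finset.mem_univ v)]

/-- Pairs of multi-indices with a given sum. -/
@[reducible]
def piNatHasAntidiagonal (J : ℕ) : Finset.HasAntidiagonal (Fin J → ℕ) where
  antidiagonal n := (Finset.Icc 0 n).image fun i => (i, n - i)
  mem_antidiagonal := by
    rintro n ⟨i, j⟩
    simp only [Finset.mem_image, Finset.mem_Icc, Prod.mk.injEq]
    constructor
    · rintro ⟨i', ⟨-, h⟩, rfl, rfl⟩
      exact add_tsub_cancel_of_le h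
    · rintro rfl
      exact ⟨i, ⟨zero_le, le_self_add⟩, rfl, add_tsub_cancel_left _ _⟩

lemma hasSum_cauchyProduct {J : ℕ} {f g : (Fin J → ℕ) → ℝ} (hf : Summable f) (hg : Summable g) :
    HasSum (fun n => ∑ i ∈ Finset.Icc 0 n, f i * g (n - i)) ((∑' n, f n) * ∑' n, g n) := by
  have hfg : Summable fun x : (Fin J → ℕ) × (Fin J → ℕ) => f x.1 * g x.2 :=
    summable_mul_of_summable_norm hf.norm hg.norm
  let inst := piNatHasAntidiagonal J
  have h1 := hf.tsum_mul_tsum_eq_tsum_sum_antidiagonal hg hfg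
  have h2 := (summable_sum_mul_antidiagonal_of_summable_mul hfg).hasSum
  rw [← h1] at h2
  refine h2.congr_fun fun n => ?_
  exact (Finset.sum_image (f := fun kl : (Fin J → ℕ) × (Fin J → ℕ) => f kl.1 * g kl.2)
    fun i _ j _ h => (Prod.mk.inj h).1).symm

lemma tsum_monomial_mul_tsum_monomial {J : ℕ} {a b : (Fin J → ℕ) → ℝ} {z : Fin J → ℝ}
    (ha : Summable fun n => a n * ∏ k, z k ^ n k) (hb : Summable fun n => b n * ∏ k, z k ^ n k) :
    HasSum (fun n => (∑ i ∈ Finset.Icc 0 n, a i * b (n - i)) * ∏ k, z k ^ n k)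
      ((∑' n, a n * ∏ k, z k ^ n k) * ∑' n, b n * ∏ k, z k ^ n k) := by
  refine (hasSum_cauchyProduct ha hb).congr_fun fun n => ?_
  rw [Finset.sum_mul]
  refine Finset.sum_congr rfl fun i hi => ?_
  have hi' : i ≤ n := (Finset.mem_Icc.1 hi).2
  have : ∏ k, z k ^ n k = (∏ k, z k ^ i k) * ∏ k, z k ^ (n - i) k := by
    rw [← Finset.prod_mul_distrib]
    refine Finset.prod_congr rfl fun k _ => ?_
    rw [← pow_add, Pi.sub_apply, add_tsub_cancel_of_le (hi' k)]
  rw [this]; ring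

/-- Panjer-type recurrence for the coefficients of the exponential of a power series. -/
theorem coeff_recurrence_of_tsum_eq_exp {J : ℕ} {a c : (Fin J → ℕ) → ℝ} (ha : Summable a)
    (hc : Summable c) {C : ℝ}
    (h : ∀ z : Fin J → ℝ, (∀ k, z k ∈ Set.Ioo (0 : ℝ) 1) →
      ∑' n, a n * ∏ k, z k ^ n k = Real.exp ((∑' n, c n * ∏ k, z k ^ n k) - C))
    (v : Fin J) (n : Fin J → ℕ) :
    n v * a n = ∑ i ∈ Finset.Icc 0 n, i v * c i * a (n - i) := by
  suffices H : (fun n : Fin J → ℕ => n v * a n - ∑ i ∈ Finset.Icc 0 n, i v * c i * a (n - i)) = 0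
    from sub_eq_zero.1 (congrFun H n)
  refine eq_zero_of_hasSum_monomial_zero fun z hz => ?_
  have hz' : ∀ k, z k ∈ Set.Icc (0 : ℝ) 1 := fun k => Set.Ioo_subset_Icc_self (hz k)
  obtain ⟨sa, da⟩ := summable_and_hasDerivAt_tsum_monomial ha hz v
  obtain ⟨sc, dc⟩ := summable_and_hasDerivAt_tsum_monomial hc hz v
  -- The exponential identity is known only in the open cube, which is enough to differentiate it in
  -- the `v`-th coordinate at an interior point.
  have hev : (fun x => ∑' n, a n * ∏ k, Function.update z v x k ^ n k) =ᶠ[nhds (z v)]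
      fun x => Real.exp ((∑' n, c n * ∏ k, Function.update z v x k ^ n k) - C) := by
    filter_upwards [Ioo_mem_nhds (hz v).1 (hz v).2] with x hx
    refine h _ fun k => ?_
    rcases eq_or_ne k v with rfl | hk
    · rwa [Function.update_self]
    · rw [Function.update_of_ne hk]; exact hz k
  have hd := da.unique (((dc.sub_const C).exp).congr_of_eventuallyEq hev)
  rw [Function.update_eq_self, ← h z hz, ← mul_div_assoc,
    div_left_inj' (hz v).1.ne'] at hd
  have h2 := tsum_monomial_mul_tsum_monomial sc (summable_monomial ha hz')
  rw [mul_comm, ← hd] at h2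
  have h3 := sa.hasSum.sub h2
  rw [sub_self] at h3
  exact h3.congr_fun fun n => by ring

/-! ### Products of Poisson laws and their mixtures -/

lemma hasSum_prod_of_nonneg {J : ℕ} {f : Fin J → ℕ → ℝ} {s : Fin J → ℝ} (h0 : ∀ k m, 0 ≤ f k m)
    (h : ∀ k, HasSum (f k) (s k)) : HasSum (fun i : Fin J → ℕ => ∏ k, f k (i k)) (∏ k, s k) := by
  induction J with
  | zero => simp
  | succ J ih =>
    have h1 := ih (f := fun k => f k.succ) (s := fun k => s k.succ) (fun k => h0 k.succ)
      fun k => h k.succ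
    have hs : Summable fun y : ℕ × (Fin J → ℕ) => f 0 y.1 * ∏ k : Fin J, f k.succ (y.2 k) :=
      Summable.mul_of_nonneg (f := f 0) (g := fun i : Fin J → ℕ => ∏ k : Fin J, f k.succ (i k))
        (h 0).summable h1.summable (h0 0) fun i => Finset.prod_nonneg fun k _ => h0 _ _
    have h2 := HasSum.mul (h 0) h1 hs
    rw [← Fin.prod_univ_succ] at h2
    refine (Equiv.hasSum_iff (Fin.consEquiv (fun _ : Fin (J + 1) => ℕ))).1 (h2.congr_fun fun y => ?_)
    simp [Fin.prod_univ_succ, Fin.consEquiv]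

lemma hasSum_prod_pow_div_factorial {J : ℕ} {x : Fin J → ℝ} (hx : ∀ k, 0 ≤ x k) :
    HasSum (fun i : Fin J → ℕ => ∏ k, x k ^ i k / (i k).factorial) (Real.exp (∑ k, x k)) := by
  rw [Real.exp_sum]
  refine hasSum_prod_of_nonneg (f := fun k m => x k ^ m / (m.factorial : ℝ))
    (fun k m => by have := hx k; positivity) fun k => ?_
  rw [Real.exp_eq_exp_ℝ]
  exact NormedSpace.expSeries_div_hasSum_exp (x k)

/-- The joint probability mass function of independent Poisson variables with means `x k`. -/
noncomputable def poissonProd {J : ℕ} (x : Fin J → ℝ) (i : Fin J → ℕ) : ℝ :=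
  (∏ k, x k ^ i k / (i k).factorial) * Real.exp (-∑ k, x k)

lemma poissonProd_nonneg {J : ℕ} {x : Fin J → ℝ} (hx : ∀ k, 0 ≤ x k) (i : Fin J → ℕ) :
    0 ≤ poissonProd x i :=
  mul_nonneg (Finset.prod_nonneg fun k _ => by have := hx k; positivity) (Real.exp_pos _).le

lemma hasSum_poissonProd_mul_monomial {J : ℕ} {x z : Fin J → ℝ} (hx : ∀ k, 0 ≤ x k)
    (hz : ∀ k, 0 ≤ z k) :
    HasSum (fun i => poissonProd x i * ∏ k, z k ^ i k) (Real.exp (∑ k, x k * (z k - 1))) := by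
  have h := (hasSum_prod_pow_div_factorial (x := fun k => x k * z k)
    fun k => mul_nonneg (hx k) (hz k)).mul_right (Real.exp (-∑ k, x k))
  rw [← Real.exp_add, ← sub_eq_add_neg, ← Finset.sum_sub_distrib] at h
  simp only [mul_sub, mul_one]
  refine h.congr_fun fun i => ?_
  rw [poissonProd, mul_right_comm, ← Finset.prod_mul_distrib]
  congr 1
  refine Finset.prod_congr rfl fun k _ => ?_
  rw [mul_pow]; ring

lemma hasSum_poissonProd {J : ℕ} {x : Fin J → ℝ} (hx : ∀ k, 0 ≤ x k) :
    HasSum (poissonProd x) 1 := by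
  simpa using hasSum_poissonProd_mul_monomial (z := fun _ => 1) hx (by simp)

lemma poissonProd_le_one {J : ℕ} {x : Fin J → ℝ} (hx : ∀ k, 0 ≤ x k) (i : Fin J → ℕ) :
    poissonProd x i ≤ 1 :=
  le_hasSum (hasSum_poissonProd hx) i fun j _ => poissonProd_nonneg hx j

section Mixture

variable {α : Type*} [MeasurableSpace α] {ν : Measure α} [IsFiniteMeasure ν] {J : ℕ}
  {Q : Fin J → α → ℝ}

lemma integrable_of_mem_unitInterval {f : α → ℝ} (hf : AEStronglyMeasurable f ν)
    (h : ∀ x, f x ∈ Set.Icc (0 : ℝ) 1) : Integrable f ν :=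
  Integrable.of_bound hf 1 (.of_forall fun x => by
    rw [Real.norm_eq_abs, abs_of_nonneg (h x).1]; exact (h x).2)

lemma measurable_poissonProd (hQ : ∀ k, Measurable (Q k)) (i : Fin J → ℕ) :
    Measurable fun τ => poissonProd (fun k => Q k τ) i := by
  unfold poissonProd
  fun_prop

/-- Sum and integral are exchanged by dominated convergence: the monomials are at most `1`, and the
Poisson masses sum to `1`, which is integrable for the finite measure `ν`. -/
lemma hasSum_integral_poissonProd (hQ : ∀ k, Measurable (Q k)) (hQ0 : ∀ k τ, 0 ≤ Q k τ)
    {z : Fin J → ℝ} (hz : ∀ k, z k ∈ Set.Icc (0 : ℝ) 1) :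
    HasSum (fun i => (∫ τ, poissonProd (fun k => Q k τ) i ∂ν) * ∏ k, z k ^ i k)
      (∫ τ, Real.exp (∑ k, Q k τ * (z k - 1)) ∂ν) := by
  simp only [← integral_mul_const]
  refine hasSum_integral_of_dominated_convergence
    (bound := fun i τ => poissonProd (fun k => Q k τ) i)
    (fun i => ((measurable_poissonProd hQ i).mul_const _).aestronglyMeasurable)
    (fun i => .of_forall fun τ => ?_)
    (.of_forall fun τ => (hasSum_poissonProd fun k => hQ0 k τ).summable) ?_
    (.of_forall fun τ => hasSum_poissonProd_mul_monomial (fun k => hQ0 k τ) fun k => (hz k).1)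
  · have h1 := poissonProd_nonneg (fun k => hQ0 k τ) i
    have h2 := prod_pow_mem_Icc Finset.univ hz i
    rw [Real.norm_eq_abs, abs_of_nonneg (mul_nonneg h1 h2.1)]
    exact mul_le_of_le_one_right h1 h2.2
  · simp only [(hasSum_poissonProd fun k => hQ0 k _).tsum_eq]
    exact integrable_const _

/-- If the generating function of `a` is that of a compound Poisson law whose jumps are a mixture
of vectors of independent Poisson variables, then `a` satisfies a Panjer-type recurrence. -/
theorem recurrence_of_pgf_eq {a : (Fin J → ℕ) → ℝ} (ha : Summable a)
    (hQ : ∀ k, Measurable (Q k)) (hQ0 : ∀ k τ, 0 ≤ Q k τ)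
    (h : ∀ z : Fin J → ℝ, (∀ k, z k ∈ Set.Ioo (0 : ℝ) 1) →
      ∑' n, a n * ∏ k, z k ^ n k =
        Real.exp (-∫ τ, (1 - Real.exp (∑ k, Q k τ * (z k - 1))) ∂ν))
    (v : Fin J) (n : Fin J → ℕ) :
    n v * a n = ∑ i ∈ Finset.Icc 0 n,
      i v * (∫ τ, poissonProd (fun k => Q k τ) i ∂ν) * a (n - i) := by
  have hc : Summable fun i => ∫ τ, poissonProd (fun k => Q k τ) i ∂ν := by
    simpa using (hasSum_integral_poissonProd (ν := ν) hQ hQ0 (z := fun _ => 1) (by simp)).summable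
  -- The constant of the exponent is the total mass of `ν`; it disappears on differentiation.
  refine coeff_recurrence_of_tsum_eq_exp ha hc (C := ∫ _, 1 ∂ν) (fun z hz => ?_) v n
  have hz' : ∀ k, z k ∈ Set.Icc (0 : ℝ) 1 := fun k => Set.Ioo_subset_Icc_self (hz k)
  rw [h z hz, (hasSum_integral_poissonProd hQ hQ0 hz').tsum_eq, integral_sub (integrable_const _),
    neg_sub]
  refine integrable_of_mem_unitInterval (Measurable.aestronglyMeasurable (by fun_prop)) fun τ =>
    ⟨(Real.exp_pos _).le, Real.exp_le_one_iff.2 (Finset.sum_nonpos fun k _ => ?_)⟩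
  exact mul_nonpos_of_nonneg_of_nonpos (hQ0 k τ) (by linarith [(hz k).2])

end Mixture

/-! ### Integrating out independent sources of randomness -/

lemma integral_comp_prodMk_of_indepFun {Ω S T : Type*} {mΩ : MeasurableSpace Ω}
    {mS : MeasurableSpace S} {mT : MeasurableSpace T} {P : Measure Ω} [IsProbabilityMeasure P]
    {X : Ω → S} {Y : Ω → T} (hX : Measurable X) (hY : Measurable Y) (hXY : IndepFun X Y P)
    {f : S × T → ℝ} (hf : Measurable f) (h01 : ∀ x, f x ∈ Set.Icc (0 : ℝ) 1) :
    ∫ ω, f (X ω, Y ω) ∂P = ∫ ω, ∫ ω', f (X ω, Y ω') ∂P ∂P := by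
  have h1 := (indepFun_iff_map_prod_eq_prod_map_map hX.aemeasurable hY.aemeasurable).1 hXY
  have := Measure.isProbabilityMeasure_map (μ := P) hX.aemeasurable
  have := Measure.isProbabilityMeasure_map (μ := P) hY.aemeasurable
  rw [← integral_map (f := f) (hX.prodMk hY).aemeasurable hf.aestronglyMeasurable, h1,
    integral_prod _ (integrable_of_mem_unitInterval hf.aestronglyMeasurable h01),
    integral_map hX.aemeasurable hf.stronglyMeasurable.integral_prod_right'.aestronglyMeasurable]
  refine integral_congr_ae (.of_forall fun ω => ?_)
  exact integral_map hY.aemeasurable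
    (hf.comp (measurable_const.prodMk measurable_id)).aestronglyMeasurable

/-- The identity of `Ω`, read once with values in `(Ω, mA)` and once in `(Ω, mB)`, gives two
independent random elements, to which Fubini applies. This handles whole route processes through
their σ-algebras alone. -/
lemma integral_diag_of_indep {Ω : Type*} {mA mB mΩ : MeasurableSpace Ω} {P : Measure Ω}
    [IsProbabilityMeasure P] (hA : mA ≤ mΩ) (hB : mB ≤ mΩ) (hAB : Indep mA mB P)
    {f : Ω × Ω → ℝ} (hf : Measurable[mA.prod mB] f) (h01 : ∀ x, f x ∈ Set.Icc (0 : ℝ) 1) :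
    ∫ ω, f (ω, ω) ∂P = ∫ ω, ∫ ω', f (ω, ω') ∂P ∂P := by
  refine @integral_comp_prodMk_of_indepFun Ω Ω Ω mΩ mA mB P _ id id (measurable_id'' hA)
    (measurable_id'' hB) ?_ f hf h01
  refine (@IndepFun_iff_Indep Ω Ω Ω mΩ mA mB id id P).2 ?_
  rwa [@MeasurableSpace.comap_id _ mA, @MeasurableSpace.comap_id _ mB]

lemma integral_mem_unitInterval {Ω : Type*} {mΩ : MeasurableSpace Ω} {P : Measure Ω}
    [IsProbabilityMeasure P] {f : Ω → ℝ} (hf : Measurable f) (h : ∀ x, f x ∈ Set.Icc (0 : ℝ) 1) :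
    ∫ ω, f ω ∂P ∈ Set.Icc (0 : ℝ) 1 := by
  refine ⟨integral_nonneg fun x => (h x).1, ?_⟩
  calc ∫ ω, f ω ∂P ≤ ∫ _, 1 ∂P :=
        integral_mono (integrable_of_mem_unitInterval hf.aestronglyMeasurable h)
          (integrable_const _) fun x => (h x).2
    _ = 1 := by simp

lemma mul_mem_unitInterval {x y : ℝ} (hx : x ∈ Set.Icc (0 : ℝ) 1) (hy : y ∈ Set.Icc (0 : ℝ) 1) :
    x * y ∈ Set.Icc (0 : ℝ) 1 :=
  ⟨mul_nonneg hx.1 hy.1, mul_le_one₀ hx.2 hy.1 hy.2⟩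

lemma prod_mem_unitInterval {ι : Type*} {s : Finset ι} {f : ι → ℝ}
    (h : ∀ i, f i ∈ Set.Icc (0 : ℝ) 1) : ∏ i ∈ s, f i ∈ Set.Icc (0 : ℝ) 1 :=
  ⟨Finset.prod_nonneg fun i _ => (h i).1, Finset.prod_le_one (fun i _ => (h i).1) fun i _ => (h i).2⟩

section Sources

variable {Ω ι C S : Type*} {mΩ : MeasurableSpace Ω} {mS : MeasurableSpace S} {P : Measure Ω}
  [IsProbabilityMeasure P] {m : ι → MeasurableSpace Ω} {src : C → ι} {A : Set ι}
  {X : C → Ω → S} {h : C → S × Ω → ℝ}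

/-- Each factor `h c (X c ω, ω)` may be replaced by its mean over the source `src c`, when `X c` is
determined by the sources in `A` and `src c ∉ A`. -/
theorem integral_mul_prod_eq_of_iIndep (hle : ∀ i, m i ≤ mΩ) (hind : iIndep m P)
    (hsrc : Function.Injective src) (hA : ∀ c, src c ∉ A)
    (hX : ∀ c, Measurable[⨆ i ∈ A, m i] (X c))
    (hh : ∀ c, Measurable[mS.prod (m (src c))] (h c))
    (h01 : ∀ c x, h c x ∈ Set.Icc (0 : ℝ) 1) (s : Finset C) {W : Ω → ℝ}
    (hW : Measurable[⨆ i ∈ A, m i] W) (hW01 : ∀ ω, W ω ∈ Set.Icc (0 : ℝ) 1) :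
    ∫ ω, W ω * ∏ c ∈ s, h c (X c ω, ω) ∂P =
      ∫ ω, W ω * ∏ c ∈ s, ∫ ω', h c (X c ω, ω') ∂P ∂P := by
  classical
  induction s using Finset.induction_on generalizing W with
  | empty => simp
  | insert a s ha ih =>
    have hprod_le : ∀ c, mS.prod (m (src c)) ≤ mS.prod mΩ := fun c =>
      sup_le_sup le_rfl (MeasurableSpace.comap_mono (hle _))
    have hmeas : ∀ c, Measurable[mS] fun x => ∫ ω', h c (x, ω') ∂P := fun c =>
      (((hh c).mono (hprod_le c) le_rfl).stronglyMeasurable.integral_prod_right').measurable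
    have hmean : ∀ c x, ∫ ω', h c (x, ω') ∂P ∈ Set.Icc (0 : ℝ) 1 := fun c x =>
      integral_mem_unitInterval
        (((hh c).mono (hprod_le c) le_rfl).comp (measurable_const.prodMk measurable_id))
        fun ω' => h01 c _
    set B : Set ι := A ∪ src '' s
    have hAB : (⨆ i ∈ A, m i) ≤ ⨆ i ∈ B, m i := biSup_mono fun i hi => Or.inl hi
    have hBle : (⨆ i ∈ B, m i) ≤ mΩ := iSup₂_le fun i _ => hle i
    have hdisj : Disjoint B {src a} := by
      rw [Set.disjoint_singleton_right]
      rintro (h' | ⟨c, hc, hca⟩)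
      · exact hA a h'
      · exact ha (hsrc hca ▸ hc)
    have hindep : Indep (⨆ i ∈ B, m i) (m (src a)) P := by
      have := indep_iSup_of_disjoint hle hind hdisj
      simpa using this
    have hZ : Measurable[⨆ i ∈ B, m i] fun ω => W ω * ∏ c ∈ s, h c (X c ω, ω) := by
      refine Measurable.mul (hW.mono hAB le_rfl) (Finset.measurable_fun_prod _ fun c hc => ?_)
      have hc' : m (src c) ≤ ⨆ i ∈ B, m i :=
        le_iSup₂_of_le (src c) (Or.inr ⟨c, hc, rfl⟩) le_rfl
      exact (hh c).comp (Measurable.prodMk ((hX c).mono hAB le_rfl) (measurable_id'' hc'))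
    have hZ01 : ∀ ω, W ω * ∏ c ∈ s, h c (X c ω, ω) ∈ Set.Icc (0 : ℝ) 1 := fun ω =>
      mul_mem_unitInterval (hW01 ω) (prod_mem_unitInterval fun c => h01 c _)
    have key := integral_diag_of_indep (P := P) hBle (hle (src a)) hindep
      (f := fun x => (W x.1 * ∏ c ∈ s, h c (X c x.1, x.1)) * h a (X a x.1, x.2))
      (by
        refine Measurable.mul ?_ ?_
        · exact hZ.comp (@measurable_fst _ _ (⨆ i ∈ B, m i) (m (src a)))
        · refine (hh a).comp (Measurable.prodMk ?_
            (@measurable_snd _ _ (⨆ i ∈ B, m i) (m (src a))))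
          exact ((hX a).mono hAB le_rfl).comp (@measurable_fst _ _ (⨆ i ∈ B, m i) (m (src a))))
      (fun x => mul_mem_unitInterval (hZ01 _) (h01 _ _))
    -- The mean that replaces the factor of `a` depends only on the sources in `A`, so it is
    -- absorbed into `W`; hence the induction over all `W`.
    have ih' := ih (W := fun ω => W ω * ∫ ω', h a (X a ω, ω') ∂P)
      (hW.mul ((hmeas a).comp (hX a))) fun ω => mul_mem_unitInterval (hW01 ω) (hmean a _)
    calc ∫ ω, W ω * ∏ c ∈ insert a s, h c (X c ω, ω) ∂P
        = ∫ ω, (W ω * ∏ c ∈ s, h c (X c ω, ω)) * h a (X a ω, ω) ∂P := by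
          refine integral_congr_ae (.of_forall fun ω => ?_)
          simp only [Finset.prod_insert ha]; ring
      _ = ∫ ω, (W ω * ∫ ω', h a (X a ω, ω') ∂P) * ∏ c ∈ s, h c (X c ω, ω) ∂P := by
          rw [key]
          refine integral_congr_ae (.of_forall fun ω => ?_)
          simp only [integral_const_mul]; ring
      _ = ∫ ω, W ω * ∏ c ∈ insert a s, ∫ ω', h c (X c ω, ω') ∂P ∂P := by
          rw [ih']
          refine integral_congr_ae (.of_forall fun ω => ?_)
          simp only [Finset.prod_insert ha]; ring

theorem integral_prod_eq_of_iIndep (hle : ∀ i, m i ≤ mΩ) (hind : iIndep m P)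
    (hsrc : Function.Injective src) (hA : ∀ c, src c ∉ A)
    (hX : ∀ c, Measurable[⨆ i ∈ A, m i] (X c))
    (hh : ∀ c, Measurable[mS.prod (m (src c))] (h c))
    (h01 : ∀ c x, h c x ∈ Set.Icc (0 : ℝ) 1) (s : Finset C) :
    ∫ ω, ∏ c ∈ s, h c (X c ω, ω) ∂P = ∫ ω, ∏ c ∈ s, ∫ ω', h c (X c ω, ω') ∂P ∂P := by
  simpa using integral_mul_prod_eq_of_iIndep hle hind hsrc hA hX hh h01 s (W := fun _ => 1)
    measurable_const (by simp)

end Sources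

/-! ### The generating functional of a Poisson process -/

lemma integral_pow_poissonMeasure (r : ℝ≥0) (x : ℝ) :
    ∫ n, x ^ n ∂(poissonMeasure r) = Real.exp (r * (x - 1)) := by
  rw [integral_poissonMeasure]
  have h : HasSum (fun n : ℕ => (r * x) ^ n / (n.factorial : ℝ)) (Real.exp (r * x)) := by
    rw [Real.exp_eq_exp_ℝ]
    exact NormedSpace.expSeries_div_hasSum_exp _
  rw [mul_sub, mul_one, sub_eq_neg_add, Real.exp_add, ← h.tsum_eq, ← tsum_mul_left]
  refine tsum_congr fun n => ?_
  rw [smul_eq_mul, mul_pow]; ring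

/-- The value of the function `f` at the point `s`, if `s` lies before `t`, and `1` otherwise. -/
noncomputable def evalBefore (t : ℝ) (f : ℝ → ℝ) (s : ℝ≥0∞) : ℝ :=
  if s < ENNReal.ofReal t then f s.toReal else 1

lemma evalBefore_mem_unitInterval {t : ℝ} {f : ℝ → ℝ} (hf : ∀ x, f x ∈ Set.Icc (0 : ℝ) 1)
    (s : ℝ≥0∞) : evalBefore t f s ∈ Set.Icc (0 : ℝ) 1 := by
  unfold evalBefore
  split_ifs
  · exact hf _
  · simp

lemma measurable_evalBefore (t : ℝ) {f : ℝ → ℝ} (hf : Measurable f) :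
    Measurable (evalBefore t f) :=
  Measurable.ite measurableSet_Iio (hf.comp ENNReal.measurable_toReal) measurable_const

lemma lt_ofReal_iff_toReal_mem_Ico {t : ℝ} {s : ℝ≥0∞} :
    s < ENNReal.ofReal t ↔ s ≠ ⊤ ∧ s.toReal ∈ Set.Ico 0 t := by
  constructor
  · intro h
    have hs : s ≠ ⊤ := (h.trans_le le_top).ne
    exact ⟨hs, ENNReal.toReal_nonneg, (ENNReal.lt_ofReal_iff_toReal_lt hs).1 h⟩
  · rintro ⟨hs, -, h⟩
    exact (ENNReal.lt_ofReal_iff_toReal_lt hs).2 h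

/-- The intensity measure on `[0, t)` of a Poisson process with the given rate function. -/
noncomputable def intensity (rate : ℝ → ℝ) (t : ℝ) : Measure ℝ :=
  (volume.restrict (Set.Ico 0 t)).withDensity fun s => ENNReal.ofReal (rate s)

lemma intensity_apply (rate : ℝ → ℝ) (t : ℝ) {B : Set ℝ} (hB : MeasurableSet B) :
    intensity rate t B = ∫⁻ s in B ∩ Set.Ico 0 t, ENNReal.ofReal (rate s) := by
  rw [intensity, withDensity_apply _ hB, Measure.restrict_restrict hB]

/-- Grouping the points before `t` by the value of `f` reduces the product to counts in finitely
many disjoint sets, whose joint law is known. -/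
lemma prod_evalBefore_eq_prod_pow {Ω : Type*} {T : ℕ → Ω → ℝ≥0∞} {t : ℝ} (f : SimpleFunc ℝ ℝ) {ω : Ω}
    (hω : {i | T i ω < ENNReal.ofReal t}.Finite) :
    ∏ᶠ i, evalBefore t f (T i ω) =
      ∏ y ∈ f.range, y ^ (pointCount T (f ⁻¹' {y} ∩ Set.Ico 0 t) ω).toNat := by
  classical
  rw [finprod_eq_prod_of_mulSupport_subset (s := hω.toFinset) _ (fun i hi => by
    by_contra h
    simp only [Set.Finite.coe_toFinset, Set.mem_ofPred_eq] at h
    exact hi (by simp [evalBefore, h]))]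
  rw [← Finset.prod_fiberwise_of_maps_to (g := fun i => f (T i ω).toReal) (t := f.range)
    (fun i _ => SimpleFunc.mem_range_self f _)]
  refine Finset.prod_congr rfl fun y _ => ?_
  have : {i | T i ω ≠ ⊤ ∧ (T i ω).toReal ∈ f ⁻¹' {y} ∩ Set.Ico 0 t} =
      (hω.toFinset.filter fun i => f (T i ω).toReal = y : Finset ℕ) := by
    ext i
    simp [lt_ofReal_iff_toReal_mem_Ico]
    tauto
  rw [pointCount, this, Set.encard_coe_eq_coe_finsetCard, ENat.toNat_natCast]
  refine Finset.prod_eq_pow_card fun i hi => ?_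
  simp only [Finset.mem_filter, Set.Finite.mem_toFinset, Set.mem_ofPred_eq] at hi
  rw [evalBefore, if_pos hi.1, hi.2]

lemma eventually_prod_range_eq_finprod {Ω : Type*} {T : ℕ → Ω → ℝ≥0∞} {t : ℝ} {g : ℕ → ℝ} {ω : Ω}
    (hω : {i | T i ω < ENNReal.ofReal t}.Finite)
    (hg : ∀ i, ¬ T i ω < ENNReal.ofReal t → g i = 1) :
    ∀ᶠ m in Filter.atTop, ∏ i ∈ Finset.range m, g i = ∏ᶠ i, g i := by
  obtain ⟨M, hM⟩ := hω.bddAbove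
  filter_upwards [Filter.eventually_gt_atTop M] with m hm
  refine (finprod_eq_prod_of_mulSupport_subset _ fun i hi => ?_).symm
  have : T i ω < ENNReal.ofReal t := by
    by_contra h
    exact hi (hg i h)
  simpa using (hM this).trans_lt hm

lemma eventually_prod_range_evalBefore {Ω : Type*} {T : ℕ → Ω → ℝ≥0∞} {t : ℝ} (f : ℝ → ℝ) {ω : Ω}
    (hω : {i | T i ω < ENNReal.ofReal t}.Finite) :
    ∀ᶠ m in Filter.atTop, ∏ i ∈ Finset.range m, evalBefore t f (T i ω) =
      ∏ᶠ i, evalBefore t f (T i ω) :=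
  eventually_prod_range_eq_finprod hω fun i hi => by rw [evalBefore, if_neg hi]

lemma finprod_mem_unitInterval {ι : Type*} {g : ι → ℝ} (hg : ∀ i, g i ∈ Set.Icc (0 : ℝ) 1) :
    ∏ᶠ i, g i ∈ Set.Icc (0 : ℝ) 1 := by
  by_cases h : (Function.mulSupport g).Finite
  · rw [finprod_eq_prod g h]; exact prod_mem_unitInterval hg
  -- By convention the product is `1` here.
  · rw [finprod_of_infinite_mulSupport h]; simp

namespace IsPoissonProcess

variable {Ω : Type*} [MeasurableSpace Ω] {P : Measure Ω} {rate : ℝ → ℝ}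
  {T : ℕ → Ω → ℝ≥0∞} {t : ℝ} [IsFiniteMeasure (intensity rate t)]

lemma hasLaw_pointCount_inter (hT : IsPoissonProcess P rate T) {B : Set ℝ}
    (hB : MeasurableSet B) :
    HasLaw (pointCount T (B ∩ Set.Ico 0 t))
      ((poissonMeasure (intensity rate t B).toNNReal).map (fun n : ℕ => (n : ℕ∞))) P := by
  refine hT.count_law _ _ (hB.inter measurableSet_Ico) (fun x hx => hx.2.1) ?_
  rw [← intensity_apply rate t hB, ENNReal.coe_toNNReal (measure_ne_top _ _)]

/-- The number of points in `[0, t)` has a Poisson law, which gives no mass to `⊤`. -/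
lemma ae_finite_setOf_lt (hT : IsPoissonProcess P rate T) :
    ∀ᵐ ω ∂P, {i | T i ω < ENNReal.ofReal t}.Finite := by
  have h := hT.hasLaw_pointCount_inter (t := t) MeasurableSet.univ
  have h1 : ∀ᵐ ω ∂P, pointCount T (Set.univ ∩ Set.Ico 0 t) ω ≠ ⊤ := by
    refine (h.ae_iff (p := fun c => c ≠ ⊤) (Measurable.of_discrete)).2 ?_
    rw [ae_map_iff (Measurable.of_discrete).aemeasurable (.of_discrete)]
    exact .of_forall fun n => ENat.natCast_ne_top n
  filter_upwards [h1] with ω hω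
  simp only [pointCount, Set.univ_inter, Set.encard_ne_top_iff] at hω
  simpa only [lt_ofReal_iff_toReal_mem_Ico] using hω

lemma integral_pow_pointCount (hT : IsPoissonProcess P rate T) {B : Set ℝ}
    (hB : MeasurableSet B) (y : ℝ) :
    ∫ ω, y ^ (pointCount T (B ∩ Set.Ico 0 t) ω).toNat ∂P =
      Real.exp ((intensity rate t).real B * (y - 1)) := by
  have h := hT.hasLaw_pointCount_inter (t := t) hB
  have h1 := h.integral_comp (f := fun c : ℕ∞ => y ^ c.toNat) .of_discrete
  simp only [Function.comp_def] at h1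
  rw [h1, integral_map (Measurable.of_discrete).aemeasurable .of_discrete]
  simp only [ENat.toNat_natCast, integral_pow_poissonMeasure]
  rfl

/-- The counts in the level sets of `f` are independent Poisson variables, so the mean is a product
of factors `exp (ν (f = y) * (y - 1))`, with `ν` the intensity, and the exponents add up to an
integral of `f - 1`. -/
lemma integral_finprod_evalBefore_simpleFunc (hT : IsPoissonProcess P rate T)
    (f : SimpleFunc ℝ ℝ) :
    ∫ ω, ∏ᶠ i, evalBefore t f (T i ω) ∂P = Real.exp (-∫ s, (1 - f s) ∂(intensity rate t)) := by
  rw [integral_congr_ae ((hT.ae_finite_setOf_lt (t := t)).mono fun ω hω =>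
    prod_evalBefore_eq_prod_pow f hω)]
  have hint : Integrable f (intensity rate t) := f.integrable_of_isFiniteMeasure
  set e := f.range.equivFin.symm
  have hreindex : ∀ g : ℝ → ℝ, ∏ y ∈ f.range, g y = ∏ l, g (e l) := fun g => by
    rw [← Finset.prod_coe_sort]
    exact (Equiv.prod_comp e fun y => g y).symm
  simp only [hreindex]
  have hind := hT.count_indep _ (fun l => f ⁻¹' {(e l : ℝ)} ∩ Set.Ico 0 t)
    (fun l => (f.measurableSet_fiber _).inter measurableSet_Ico) (fun l x hx => hx.2.1)
    (fun l l' hl => by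
      refine Set.disjoint_left.2 fun x hx hx' => hl (e.injective (Subtype.ext ?_))
      exact (Set.mem_singleton_iff.1 hx.1).symm.trans (Set.mem_singleton_iff.1 hx'.1))
  rw [hind.integral_fun_prod_comp (f := fun l c => (e l : ℝ) ^ c.toNat)
    (fun l => (hT.hasLaw_pointCount_inter (f.measurableSet_fiber _)).aemeasurable)
    (fun l => .of_discrete)]
  rw [← hreindex fun y => ∫ ω, y ^ (pointCount T (f ⁻¹' {y} ∩ Set.Ico 0 t) ω).toNat ∂P]
  simp only [hT.integral_pow_pointCount (f.measurableSet_fiber _)]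
  rw [← Real.exp_sum, integral_sub (integrable_const _) hint, neg_sub,
    f.integral_eq_integral hint |>.symm, SimpleFunc.integral_eq]
  congr 1
  have h1 : ∫ _, (1 : ℝ) ∂(intensity rate t) = ∑ y ∈ f.range, (intensity rate t).real (f ⁻¹' {y}) := by
    rw [integral_const, smul_eq_mul, mul_one, measureReal_def,
      ← f.sum_range_measure_preimage_singleton, ENNReal.toReal_sum fun _ _ => measure_ne_top _ _]
    rfl
  rw [h1, ← Finset.sum_sub_distrib]
  exact Finset.sum_congr rfl fun y _ => by rw [smul_eq_mul]; ring

lemma aestronglyMeasurable_finprod_evalBefore (hT : IsPoissonProcess P rate T) {f : ℝ → ℝ}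
    (hf : Measurable f) :
    AEStronglyMeasurable (fun ω => ∏ᶠ i, evalBefore t f (T i ω)) P := by
  refine aestronglyMeasurable_of_tendsto_ae Filter.atTop
    (f := fun m ω => ∏ i ∈ Finset.range m, evalBefore t f (T i ω)) (fun m => ?_) ?_
  · exact (Finset.measurable_fun_prod _ fun i _ =>
      (measurable_evalBefore t hf).comp (hT.measurable_point i)).aestronglyMeasurable
  · filter_upwards [hT.ae_finite_setOf_lt (t := t)] with ω hω
    exact tendsto_const_nhds.congr' ((eventually_prod_range_evalBefore f hω).mono fun m h => h.symm)

/-- Approximation by simple functions with values in `[0, 1]`: almost surely the product is finite,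
so it converges pointwise, and both sides pass to the limit by bounded convergence. -/
lemma integral_finprod_evalBefore [IsProbabilityMeasure P] (hT : IsPoissonProcess P rate T) {f : ℝ → ℝ}
    (hf : Measurable f) (h01 : ∀ x, f x ∈ Set.Icc (0 : ℝ) 1) :
    ∫ ω, ∏ᶠ i, evalBefore t f (T i ω) ∂P = Real.exp (-∫ s, (1 - f s) ∂(intensity rate t)) := by
  set F := SimpleFunc.approxOn f hf (Set.Icc 0 1) 0 (by simp)
  have hF01 : ∀ n x, F n x ∈ Set.Icc (0 : ℝ) 1 := SimpleFunc.approxOn_mem hf (by simp)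
  have hFf : ∀ x, Filter.Tendsto (fun n => F n x) Filter.atTop (nhds (f x)) := fun x =>
    SimpleFunc.tendsto_approxOn hf _ (subset_closure (h01 x))
  have h1 : Filter.Tendsto (fun n => ∫ ω, ∏ᶠ i, evalBefore t (F n) (T i ω) ∂P) Filter.atTop
      (nhds (∫ ω, ∏ᶠ i, evalBefore t f (T i ω) ∂P)) := by
    refine tendsto_integral_of_dominated_convergence (fun _ => 1)
      (fun n => hT.aestronglyMeasurable_finprod_evalBefore (F n).measurable) (integrable_const _)
      (fun n => .of_forall fun ω => ?_) ?_
    · have := finprod_mem_unitInterval fun i =>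
        evalBefore_mem_unitInterval (t := t) (hF01 n) (T i ω)
      rw [Real.norm_eq_abs, abs_of_nonneg this.1]; exact this.2
    · filter_upwards [hT.ae_finite_setOf_lt (t := t)] with ω hω
      have hsub : ∀ g : ℝ → ℝ, ∏ᶠ i, evalBefore t g (T i ω) =
          ∏ i ∈ hω.toFinset, evalBefore t g (T i ω) := fun g =>
        finprod_eq_prod_of_mulSupport_subset _ fun i hi => by
          by_contra h
          simp only [Set.Finite.coe_toFinset, Set.mem_ofPred_eq] at h
          exact hi (by simp [evalBefore, h])
      simp only [hsub]
      refine tendsto_finsetProd _ fun i _ => ?_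
      unfold evalBefore
      split_ifs
      · exact hFf _
      · exact tendsto_const_nhds
  have h2 : Filter.Tendsto (fun n => Real.exp (-∫ s, (1 - F n s) ∂(intensity rate t))) Filter.atTop
      (nhds (Real.exp (-∫ s, (1 - f s) ∂(intensity rate t)))) := by
    refine (Real.continuous_exp.tendsto _).comp (Filter.Tendsto.neg ?_)
    refine tendsto_integral_of_dominated_convergence (fun _ => 1)
      (fun n => (measurable_const.sub (F n).measurable).aestronglyMeasurable) (integrable_const _)
      (fun n => .of_forall fun x => ?_) (.of_forall fun x => (hFf x).const_sub 1)
    have := hF01 n x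
    rw [Real.norm_eq_abs, abs_le]; constructor <;> linarith [this.1, this.2]
  exact tendsto_nhds_unique h1 (h2.congr fun n => (hT.integral_finprod_evalBefore_simpleFunc _).symm)

end IsPoissonProcess

/-! ### The generating function of the queue lengths -/

/-- The truncation `max 0` keeps the elapsed time in `[0, ∞)`, where joint measurability is
available, and changes nothing for arrivals before `t`. The σ-algebra `m` is arbitrary so that it
can be the one generated by a single route. -/
lemma measurableSet_present {Ω E : Type*} {m : MeasurableSpace Ω} {Y : ℝ → Ω → E} {e : E}
    (h : MeasurableSet {x : Set.Ici (0 : ℝ) × Ω | Y x.1 x.2 = e}) (t : ℝ) (l : ℕ) :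
    MeasurableSet {x : (ℝ≥0∞ × ℕ) × Ω | x.1.1 < ENNReal.ofReal t ∧ l < x.1.2 ∧
      Y (max 0 (t - x.1.1.toReal)) x.2 = e} := by
  have h1 : Measurable fun x : (ℝ≥0∞ × ℕ) × Ω => x.1.1 := by fun_prop
  have h2 : Measurable fun x : (ℝ≥0∞ × ℕ) × Ω => x.1.2 := by fun_prop
  refine (measurableSet_lt h1 measurable_const).inter
    ((measurableSet_lt measurable_const h2).inter ?_)
  have hφ : Measurable fun x : (ℝ≥0∞ × ℕ) × Ω =>
      ((⟨max 0 (t - x.1.1.toReal), Set.mem_Ici.2 (le_max_left _ _)⟩ : Set.Ici (0 : ℝ)), x.2) := by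
    refine Measurable.prodMk (Measurable.subtype_mk ?_) measurable_snd
    exact measurable_const.max (measurable_const.sub (by fun_prop))
  exact hφ h

/-- The weight `z k` if the location is the queue `k`, and `1` if it is outside the network. -/
noncomputable def locationWeight {J : ℕ} (z : Fin J → ℝ) (o : Option (Fin J)) : ℝ :=
  ∏ k, if o = some k then z k else 1

/-- A customer is in at most one queue, so at most one factor differs from `1`. The additive form
makes the expectation linear in the location probabilities. -/
lemma locationWeight_eq_one_add {J : ℕ} (z : Fin J → ℝ) (o : Option (Fin J)) :
    locationWeight z o = 1 + ∑ k, if o = some k then z k - 1 else 0 := by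
  unfold locationWeight
  cases o with
  | none => simp
  | some j => simp

lemma locationWeight_mem_unitInterval {J : ℕ} {z : Fin J → ℝ}
    (hz : ∀ k, z k ∈ Set.Icc (0 : ℝ) 1) (o : Option (Fin J)) :
    locationWeight z o ∈ Set.Icc (0 : ℝ) 1 :=
  prod_mem_unitInterval fun k => by
    split_ifs
    · exact hz k
    · simp

/-- The mean weight, at time `t`, of a customer who entered at queue `j` at time `τ`. -/
def meanWeight {J : ℕ} (q : Fin J → Fin J → ℝ → ℝ) (t : ℝ) (z : Fin J → ℝ) (j : Fin J) (τ : ℝ) :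
    ℝ :=
  1 + ∑ k, q j k (max 0 (t - τ)) * (z k - 1)

namespace BatchNetwork

variable {Ω : Type*} {J : ℕ}

/-- The index set of the potential customers `(i, j, l)`. -/
abbrev CustomerIndex (J : ℕ) := ℕ × Fin J × ℕ

/-- The source of randomness of a potential customer. -/
def CustomerIndex.source (c : CustomerIndex J) : Source J := .customer c.1 c.2.1 c.2.2

lemma CustomerIndex.source_injective :
    Function.Injective (CustomerIndex.source : CustomerIndex J → Source J) := by
  rintro ⟨i, j, l⟩ ⟨i', j', l'⟩ h
  simpa [CustomerIndex.source] using h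

/-- The arrival time of the batch of a potential customer, and the number of customers who enter
with the same batch at the same queue. -/
def entry (N : BatchNetwork Ω J) (c : CustomerIndex J) (ω : Ω) : ℝ≥0∞ × ℕ :=
  (N.arrival c.1 ω, N.batch c.1 ω c.2.1)

/-- The event that the potential customer `c` is in queue `k` at time `t`, given its entry data. -/
def presentSet (N : BatchNetwork Ω J) (t : ℝ) (c : CustomerIndex J) (k : Fin J) :
    Set ((ℝ≥0∞ × ℕ) × Ω) :=
  {x | x.1.1 < ENNReal.ofReal t ∧ c.2.2 < x.1.2 ∧
    N.location c.1 c.2.1 c.2.2 (max 0 (t - x.1.1.toReal)) x.2 = some k}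

open Classical in
/-- The weight at time `t` of the potential customer `c`, given its entry data. -/
noncomputable def customerWeight (N : BatchNetwork Ω J) (t : ℝ) (z : Fin J → ℝ)
    (c : CustomerIndex J) (x : (ℝ≥0∞ × ℕ) × Ω) : ℝ :=
  ∏ k, if x ∈ N.presentSet t c k then z k else 1

lemma customerWeight_eq (N : BatchNetwork Ω J) (t : ℝ) (z : Fin J → ℝ) (c : CustomerIndex J)
    (x : (ℝ≥0∞ × ℕ) × Ω) :
    N.customerWeight t z c x = if x.1.1 < ENNReal.ofReal t ∧ c.2.2 < x.1.2 then
      locationWeight z (N.location c.1 c.2.1 c.2.2 (max 0 (t - x.1.1.toReal)) x.2) else 1 := by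
  unfold customerWeight locationWeight presentSet
  split_ifs with h
  · simp [h.1, h.2]
  · refine Finset.prod_eq_one fun k _ => if_neg fun hx => h ⟨hx.1, hx.2.1⟩

lemma customerWeight_mem_unitInterval (N : BatchNetwork Ω J) (t : ℝ) {z : Fin J → ℝ}
    (hz : ∀ k, z k ∈ Set.Icc (0 : ℝ) 1) (c : CustomerIndex J) (x : (ℝ≥0∞ × ℕ) × Ω) :
    N.customerWeight t z c x ∈ Set.Icc (0 : ℝ) 1 := by
  rw [customerWeight_eq]
  split_ifs
  · exact locationWeight_mem_unitInterval hz _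
  · simp

lemma entry_mem_presentSet_iff (N : BatchNetwork Ω J) {t : ℝ} {c : CustomerIndex J} {k : Fin J}
    {ω : Ω} : (N.entry c ω, ω) ∈ N.presentSet t c k ↔
      N.arrival c.1 ω < ENNReal.ofReal t ∧ c.2.2 < N.batch c.1 ω c.2.1 ∧
        N.location c.1 c.2.1 c.2.2 (t - (N.arrival c.1 ω).toReal) ω = some k := by
  refine and_congr_right fun h => ?_
  have : (N.arrival c.1 ω).toReal < t := (lt_ofReal_iff_toReal_mem_Ico.1 h).2.2
  simp only [entry]
  rw [max_eq_right (sub_nonneg.2 this.le)]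

/-- The first `m` potential customers at each queue of the first `m` batches. -/
def customerBox (J m : ℕ) : Finset (CustomerIndex J) :=
  Finset.range m ×ˢ Finset.univ ×ˢ Finset.range m

/-- The weight at time `t` of a batch that arrived at time `s`. -/
noncomputable def batchWeight (N : BatchNetwork Ω J) (q : Fin J → Fin J → ℝ → ℝ) (t : ℝ)
    (z : Fin J → ℝ) (i : ℕ) (x : ℝ≥0∞ × Ω) : ℝ :=
  if x.1 < ENNReal.ofReal t then ∏ j, meanWeight q t z j x.1.toReal ^ N.batch i x.2 j else 1

lemma eventually_customerBox (N : BatchNetwork Ω J) {t : ℝ} {ω : Ω}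
    (hω : {i | N.arrival i ω < ENNReal.ofReal t}.Finite) :
    ∀ᶠ m in Filter.atTop, ∀ i ∈ {i | N.arrival i ω < ENNReal.ofReal t},
      i < m ∧ ∀ j, N.batch i ω j ≤ m := by
  rw [Filter.eventually_all_finite hω]
  intro i _
  exact (Filter.eventually_gt_atTop i).and
    (Filter.eventually_all.2 fun j => Filter.eventually_ge_atTop _)

lemma eventually_card_filter_customerBox (N : BatchNetwork Ω J) {t : ℝ} {ω : Ω}
    (hω : {i | N.arrival i ω < ENNReal.ofReal t}.Finite) :
    open Classical in
    ∀ᶠ m in Filter.atTop, ∀ k, N.occupancy t k ω =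
      (((customerBox J m).filter fun c => (N.entry c ω, ω) ∈ N.presentSet t c k).card : ℕ∞) := by
  classical
  filter_upwards [N.eventually_customerBox hω] with m hm k
  rw [← Set.encard_coe_eq_coe_finsetCard, occupancy]
  congr 1
  ext c
  simp only [Finset.coe_filter, entry_mem_presentSet_iff, Set.mem_ofPred_eq]
  refine ⟨fun h => ⟨?_, h⟩, fun h => h.2⟩
  have := hm c.1 h.1
  simp only [customerBox, Finset.mem_product, Finset.mem_range, Finset.mem_univ, true_and]
  exact ⟨this.1, h.2.1.trans_le (this.2 _)⟩

/-- After exchanging the products over customers and queues, `z k` occurs once for each customer in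
queue `k`. -/
lemma eventually_prod_customerWeight (N : BatchNetwork Ω J) {t : ℝ} {ω : Ω} (z : Fin J → ℝ)
    (hω : {i | N.arrival i ω < ENNReal.ofReal t}.Finite) :
    ∀ᶠ m in Filter.atTop, ∏ c ∈ customerBox J m, N.customerWeight t z c (N.entry c ω, ω) =
      ∏ k, z k ^ (N.occupancy t k ω).toNat := by
  classical
  filter_upwards [N.eventually_card_filter_customerBox hω] with m hm
  unfold customerWeight
  rw [Finset.prod_comm]
  refine Finset.prod_congr rfl fun k _ => ?_
  rw [hm k, ENat.toNat_natCast, Finset.prod_ite, Finset.prod_const_one, mul_one,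
    Finset.prod_const]

/-- All customers of a batch at the same queue share one mean weight, which gives a power. A small
box would truncate the exponent, so equality holds only for large `m`. -/
lemma eventually_prod_meanWeight (N : BatchNetwork Ω J) (q : Fin J → Fin J → ℝ → ℝ) {t : ℝ} {ω : Ω}
    (z : Fin J → ℝ) (hω : {i | N.arrival i ω < ENNReal.ofReal t}.Finite) :
    ∀ᶠ m in Filter.atTop, ∏ c ∈ customerBox J m,
      (if (N.entry c ω).1 < ENNReal.ofReal t ∧ c.2.2 < (N.entry c ω).2 then
        meanWeight q t z c.2.1 (N.entry c ω).1.toReal else 1) =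
      ∏ i ∈ Finset.range m, N.batchWeight q t z i (N.arrival i ω, ω) := by
  filter_upwards [N.eventually_customerBox hω] with m hm
  rw [customerBox, Finset.prod_product]
  refine Finset.prod_congr rfl fun i _ => ?_
  rw [Finset.prod_product, batchWeight]
  simp only [entry]
  split_ifs with hi
  · refine Finset.prod_congr rfl fun j _ => ?_
    simp only [hi, true_and]
    rw [Finset.prod_ite, Finset.prod_const_one, mul_one, Finset.prod_const]
    congr 1
    have hb := (hm i hi).2 j
    have : (Finset.range m).filter (fun l => l < N.batch i ω j) = Finset.range (N.batch i ω j) := by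
      ext l
      simp only [Finset.mem_filter, Finset.mem_range]
      omega
    rw [this, Finset.card_range]
  · simp [hi]

/-- The vector of queue lengths at time `t`. -/
noncomputable def queueLengths (N : BatchNetwork Ω J) (t : ℝ) (ω : Ω) (k : Fin J) : ℕ :=
  (N.occupancy t k ω).toNat

lemma occupancy_eq_queueLengths (N : BatchNetwork Ω J) {t : ℝ} {ω : Ω}
    (hω : {i | N.arrival i ω < ENNReal.ofReal t}.Finite) (k : Fin J) :
    N.occupancy t k ω = N.queueLengths t ω k := by
  classical
  obtain ⟨m, hm⟩ := (N.eventually_card_filter_customerBox hω).exists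
  rw [queueLengths, hm k, ENat.toNat_natCast]

/-! ### Measurability and mean weights under the model assumptions -/

namespace IsModel

variable [mΩ : MeasurableSpace Ω] {N : BatchNetwork Ω J} {P : Measure Ω} {rate : ℝ → ℝ}
  {q : Fin J → Fin J → ℝ → ℝ}

lemma routeSigma_le (hN : N.IsModel P rate q) (i : ℕ) (j : Fin J) (l : ℕ) :
    routeSigma (N.location i j l) ≤ mΩ := by
  refine iSup_le fun s => ?_
  let _ : MeasurableSpace (Option (Fin J)) := ⊤
  have : DiscreteMeasurableSpace (Option (Fin J)) := ⟨fun _ => trivial⟩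
  have : Measurable (N.location i j l s) := by
    have hsome : ∀ k, MeasurableSet (N.location i j l s ⁻¹' {some k}) :=
      hN.measurable_location i j l s s.2
    refine measurable_to_countable' fun o => ?_
    cases o with
    | some k => exact hsome k
    | none =>
      have : N.location i j l s ⁻¹' {none} = (⋃ k, N.location i j l s ⁻¹' {some k})ᶜ := by
        ext ω
        simp [Option.eq_none_iff_forall_ne_some]
      rw [this]
      exact (MeasurableSet.iUnion hsome).compl
  exact this.comap_le

lemma sourceSigma_le (hN : N.IsModel P rate q) (σ : Source J) : N.sourceSigma σ ≤ mΩ := by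
  cases σ with
  | arrivals => exact iSup_le fun i => (hN.isPoissonProcess.measurable_point i).comap_le
  | batch i => exact (hN.measurable_batch i).comap_le
  | customer i j l => exact hN.routeSigma_le i j l

lemma measurableSet_presentSet (hN : N.IsModel P rate q) (t : ℝ) (c : CustomerIndex J)
    (k : Fin J) :
    MeasurableSet[(inferInstance : MeasurableSpace (ℝ≥0∞ × ℕ)).prod (N.sourceSigma c.source)]
      (N.presentSet t c k) :=
  @measurableSet_present Ω (Option (Fin J)) (routeSigma (N.location c.1 c.2.1 c.2.2)) _ _
    (hN.jointly_measurable_location c.1 c.2.1 c.2.2 k) t c.2.2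

lemma measurable_customerWeight (hN : N.IsModel P rate q) (t : ℝ) (z : Fin J → ℝ)
    (c : CustomerIndex J) :
    Measurable[(inferInstance : MeasurableSpace (ℝ≥0∞ × ℕ)).prod (N.sourceSigma c.source)]
      (N.customerWeight t z c) := by
  classical
  exact Finset.measurable_fun_prod _ fun k _ =>
    Measurable.ite (hN.measurableSet_presentSet t c k) measurable_const measurable_const

lemma measurable_entry (hN : N.IsModel P rate q) (c : CustomerIndex J) :
    Measurable (N.entry c) :=
  (hN.isPoissonProcess.measurable_point c.1).prodMk
    ((measurable_pi_apply c.2.1).comp (hN.measurable_batch c.1))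

lemma measurableSet_entry_mem (hN : N.IsModel P rate q) (t : ℝ) (c : CustomerIndex J)
    (k : Fin J) : MeasurableSet {ω | (N.entry c ω, ω) ∈ N.presentSet t c k} := by
  have hle : (inferInstance : MeasurableSpace (ℝ≥0∞ × ℕ)).prod (N.sourceSigma c.source) ≤
      (inferInstance : MeasurableSpace (ℝ≥0∞ × ℕ)).prod mΩ :=
    sup_le_sup le_rfl (MeasurableSpace.comap_mono (hN.sourceSigma_le _))
  exact ((hN.measurable_entry c).prodMk measurable_id) (hle _ (hN.measurableSet_presentSet t c k))

/-- The probabilities `q j k s` are the measures of the sections of a jointly measurable set; the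
customer `(0, j, 0)` serves as a representative. -/
lemma measurable_location_prob (hN : N.IsModel P rate q) [IsProbabilityMeasure P] (t : ℝ)
    (j k : Fin J) : Measurable fun τ => q j k (max 0 (t - τ)) := by
  have hle : (inferInstance : MeasurableSpace (Set.Ici (0 : ℝ))).prod
      (routeSigma (N.location 0 j 0)) ≤ (inferInstance : MeasurableSpace (Set.Ici (0 : ℝ))).prod mΩ :=
    sup_le_sup le_rfl (MeasurableSpace.comap_mono (hN.routeSigma_le _ _ _))
  have h1 : Measurable fun s : Set.Ici (0 : ℝ) => P.real {ω | N.location 0 j 0 s ω = some k} :=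
    (measurable_measure_prodMk_left (ν := P)
      (hle _ (hN.jointly_measurable_location 0 j 0 k))).ennreal_toReal
  have h2 : Measurable fun τ : ℝ =>
      (⟨max 0 (t - τ), Set.mem_Ici.2 (le_max_left _ _)⟩ : Set.Ici (0 : ℝ)) :=
    Measurable.subtype_mk (measurable_const.max (measurable_const.sub measurable_id))
  convert h1.comp h2 using 1
  funext τ
  exact (hN.location_law 0 j 0 _ (le_max_left _ _) k).symm

lemma location_prob_nonneg (hN : N.IsModel P rate q) {s : ℝ} (hs : 0 ≤ s) (j k : Fin J) :
    0 ≤ q j k s := by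
  rw [← hN.location_law 0 j 0 s hs k]
  exact measureReal_nonneg

lemma measurable_meanWeight (hN : N.IsModel P rate q) [IsProbabilityMeasure P] (t : ℝ)
    (z : Fin J → ℝ) (j : Fin J) : Measurable (meanWeight q t z j) :=
  measurable_const.add (Finset.measurable_fun_sum _ fun k _ =>
    (hN.measurable_location_prob t j k).mul_const _)

lemma measurable_locationWeight (hN : N.IsModel P rate q) (z : Fin J → ℝ) (i : ℕ) (j : Fin J)
    (l : ℕ) {s : ℝ} (hs : 0 ≤ s) : Measurable fun ω => locationWeight z (N.location i j l s ω) :=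
  Finset.measurable_fun_prod _ fun k _ =>
    Measurable.ite (hN.measurable_location i j l s hs k) measurable_const measurable_const

lemma integral_locationWeight (hN : N.IsModel P rate q) [IsProbabilityMeasure P] (z : Fin J → ℝ)
    (i : ℕ) (j : Fin J) (l : ℕ) (t τ : ℝ) :
    ∫ ω, locationWeight z (N.location i j l (max 0 (t - τ)) ω) ∂P = meanWeight q t z j τ := by
  have hs : 0 ≤ max 0 (t - τ) := le_max_left _ _
  have hind : ∀ k, (fun ω => if N.location i j l (max 0 (t - τ)) ω = some k then z k - 1 else 0) =
      {ω | N.location i j l (max 0 (t - τ)) ω = some k}.indicator fun _ => z k - 1 := fun k => by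
    funext ω
    simp [Set.indicator_apply]
  simp only [locationWeight_eq_one_add]
  rw [integral_add (integrable_const _), integral_finsetSum]
  · simp only [hind, integral_indicator_const _ (hN.measurable_location i j l _ hs _),
      hN.location_law i j l _ hs, smul_eq_mul, meanWeight]
    simp
  · intro k _
    rw [hind]
    exact (integrable_const _).indicator (hN.measurable_location i j l _ hs k)
  · refine integrable_finsetSum _ fun k _ => ?_
    rw [hind]
    exact (integrable_const _).indicator (hN.measurable_location i j l _ hs k)

lemma meanWeight_mem_unitInterval (hN : N.IsModel P rate q) [IsProbabilityMeasure P] (t : ℝ)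
    {z : Fin J → ℝ} (hz : ∀ k, z k ∈ Set.Icc (0 : ℝ) 1) (j : Fin J) (τ : ℝ) :
    meanWeight q t z j τ ∈ Set.Icc (0 : ℝ) 1 := by
  rw [← hN.integral_locationWeight z 0 j 0]
  exact integral_mem_unitInterval (hN.measurable_locationWeight z 0 j 0 (le_max_left _ _))
    fun ω => locationWeight_mem_unitInterval hz _

lemma integral_customerWeight (hN : N.IsModel P rate q) [IsProbabilityMeasure P] (t : ℝ)
    (z : Fin J → ℝ) (c : CustomerIndex J) (x : ℝ≥0∞ × ℕ) :
    ∫ ω, N.customerWeight t z c (x, ω) ∂P =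
      if x.1 < ENNReal.ofReal t ∧ c.2.2 < x.2 then meanWeight q t z c.2.1 x.1.toReal else 1 := by
  simp only [customerWeight_eq]
  split_ifs
  · exact hN.integral_locationWeight z _ _ _ _ _
  · simp

/-- The queue lengths are limits of measurable counts over finite boxes, but only where finitely
many batches arrive before `t`; hence measurability up to a null set. -/
lemma aemeasurable_queueLengths (hN : N.IsModel P rate q) (t : ℝ)
    [IsFiniteMeasure (intensity rate t)] : AEMeasurable (N.queueLengths t) P := by
  classical
  refine aemeasurable_pi_iff.2 fun k => aemeasurable_of_tendsto_metrizable_ae Filter.atTop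
    (f := fun m ω =>
      ((customerBox J m).filter fun c => (N.entry c ω, ω) ∈ N.presentSet t c k).card)
    (fun m => ?_) ?_
  · simp only [Finset.card_filter]
    exact (Finset.measurable_fun_sum _ fun c _ => Measurable.ite
      (hN.measurableSet_entry_mem t c k) measurable_const measurable_const).aemeasurable
  · filter_upwards [hN.isPoissonProcess.ae_finite_setOf_lt (t := t)] with ω hω
    refine tendsto_const_nhds.congr' ?_
    filter_upwards [N.eventually_card_filter_customerBox hω] with m hm
    rw [queueLengths, hm k, ENat.toNat_natCast]

lemma occupancyProb_eq_map (hN : N.IsModel P rate q) (t : ℝ)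
    [IsFiniteMeasure (intensity rate t)] (n : Fin J → ℕ) :
    N.occupancyProb P t n = (P.map (N.queueLengths t)).real {n} := by
  rw [map_measureReal_apply_of_aemeasurable (hN.aemeasurable_queueLengths t)
    (measurableSet_singleton n), occupancyProb]
  refine measureReal_congr ?_
  filter_upwards [hN.isPoissonProcess.ae_finite_setOf_lt (t := t)] with ω hω
  refine propext ?_
  change (∀ k, N.occupancy t k ω = n k) ↔ N.queueLengths t ω = n
  simp only [N.occupancy_eq_queueLengths hω, Nat.cast_inj, funext_iff]

end IsModel

end BatchNetwork

/-! ### Averaging over routes, batches and arrivals -/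

lemma tendsto_integral_of_ae_eventually_eq {Ω : Type*} [MeasurableSpace Ω] {P : Measure Ω}
    [IsFiniteMeasure P] {f : ℕ → Ω → ℝ} {g : Ω → ℝ} (hf : ∀ m, Measurable (f m))
    (h01 : ∀ m ω, f m ω ∈ Set.Icc (0 : ℝ) 1)
    (h : ∀ᵐ ω ∂P, ∀ᶠ m in Filter.atTop, f m ω = g ω) :
    Filter.Tendsto (fun m => ∫ ω, f m ω ∂P) Filter.atTop (nhds (∫ ω, g ω ∂P)) := by
  refine tendsto_integral_of_dominated_convergence (fun _ => 1)
    (fun m => (hf m).aestronglyMeasurable) (integrable_const _) (fun m => .of_forall fun ω => ?_) ?_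
  · rw [Real.norm_eq_abs, abs_of_nonneg (h01 m ω).1]; exact (h01 m ω).2
  · filter_upwards [h] with ω hω
    exact tendsto_const_nhds.congr' (hω.mono fun m hm => hm.symm)

lemma measurable_ite_prod_pow {Ω : Type*} {J : ℕ} {m : MeasurableSpace Ω} {b : Ω → Fin J → ℕ}
    (hb : Measurable b) {g : Fin J → ℝ → ℝ} (hg : ∀ j, Measurable (g j)) (t : ℝ) :
    Measurable fun x : ℝ≥0∞ × Ω =>
      if x.1 < ENNReal.ofReal t then ∏ j, g j x.1.toReal ^ b x.2 j else 1 := by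
  refine Measurable.ite (measurableSet_lt measurable_fst measurable_const)
    (Finset.measurable_fun_prod _ fun j _ => ?_) measurable_const
  exact ((hg j).comp (ENNReal.measurable_toReal.comp measurable_fst)).pow
    ((measurable_pi_apply j).comp (hb.comp measurable_snd))

namespace BatchNetwork

variable {Ω : Type*} {J : ℕ}

lemma integral_prod_pow_batch [MeasurableSpace Ω] {N : BatchNetwork Ω J} {P : Measure Ω}
    {p : Fin J → ℝ} {μ : ℝ≥0} (hbatch : N.HasUnivariateBatches P (poissonMeasure μ) p) (i : ℕ)
    {g : Fin J → ℝ} (hg : ∀ j, g j ∈ Set.Icc (0 : ℝ) 1) :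
    ∫ ω, ∏ j, g j ^ N.batch i ω j ∂P = Real.exp (μ * (∑ j, p j * g j - 1)) := by
  have h := hbatch.pgf_eq i (fun j => (g j : ℂ)) fun j => by
    rw [Complex.norm_real, Real.norm_eq_abs, abs_of_nonneg (hg j).1]; exact (hg j).2
  have h1 : vectorPGF P (N.batch i) (fun j => (g j : ℂ)) =
      ((∫ ω, ∏ j, g j ^ N.batch i ω j ∂P : ℝ) : ℂ) := by
    rw [vectorPGF, ← integral_complex_ofReal]
    push_cast
    rfl
  have h2 : scalarPGF (poissonMeasure μ) (∑ j, (p j : ℂ) * (g j : ℂ)) =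
      ((∫ n, (∑ j, p j * g j) ^ n ∂(poissonMeasure μ) : ℝ) : ℂ) := by
    rw [scalarPGF, ← integral_complex_ofReal]
    push_cast
    rfl
  rw [h1, h2, integral_pow_poissonMeasure] at h
  exact_mod_cast h

/-- The mean number of customers in queue `k` at time `t` from a batch that arrived at time `τ`. -/
noncomputable def batchMean (μ : ℝ≥0) (p : Fin J → ℝ) (q : Fin J → Fin J → ℝ → ℝ) (t : ℝ)
    (k : Fin J) (τ : ℝ) : ℝ :=
  μ * mixedLocation p q k (max 0 (t - τ))

/-- Poisson thinning at the level of exponents: since the `p j` sum to `1`, the constant terms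
cancel and the exponent splits over the queues. -/
lemma sum_mul_meanWeight {p : Fin J → ℝ} (hp : ∑ j, p j = 1) (μ : ℝ≥0)
    (q : Fin J → Fin J → ℝ → ℝ) (t : ℝ) (z : Fin J → ℝ) (τ : ℝ) :
    μ * (∑ j, p j * meanWeight q t z j τ - 1) = ∑ k, batchMean μ p q t k τ * (z k - 1) := by
  simp only [meanWeight, mul_add, mul_one, Finset.sum_add_distrib, hp, add_sub_cancel_left,
    batchMean, mixedLocation, Finset.mul_sum, Finset.sum_mul]
  rw [Finset.sum_comm]
  refine Finset.sum_congr rfl fun k _ => Finset.sum_congr rfl fun j _ => by ring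

namespace IsModel

variable [mΩ : MeasurableSpace Ω] {N : BatchNetwork Ω J} {P : Measure Ω} [IsProbabilityMeasure P]
  {rate : ℝ → ℝ} {q : Fin J → Fin J → ℝ → ℝ} {p : Fin J → ℝ} {μ : ℝ≥0}

lemma measurable_batchMean (hN : N.IsModel P rate q) (μ : ℝ≥0) (p : Fin J → ℝ) (t : ℝ)
    (k : Fin J) : Measurable (batchMean μ p q t k) :=
  measurable_const.mul (Finset.measurable_fun_sum _ fun j _ =>
    measurable_const.mul (hN.measurable_location_prob t j k))

lemma measurable_batchWeight (hN : N.IsModel P rate q) (t : ℝ) (z : Fin J → ℝ) (i : ℕ) :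
    Measurable[(inferInstance : MeasurableSpace ℝ≥0∞).prod (N.sourceSigma (.batch i))]
      (N.batchWeight q t z i) :=
  @measurable_ite_prod_pow Ω J (MeasurableSpace.comap (N.batch i) inferInstance) (N.batch i)
    (comap_measurable _) _ (hN.measurable_meanWeight t z) t

lemma batchWeight_mem_unitInterval (hN : N.IsModel P rate q) (t : ℝ) {z : Fin J → ℝ}
    (hz : ∀ k, z k ∈ Set.Icc (0 : ℝ) 1) (i : ℕ) (x : ℝ≥0∞ × Ω) :
    N.batchWeight q t z i x ∈ Set.Icc (0 : ℝ) 1 := by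
  unfold batchWeight
  split_ifs
  · exact prod_pow_mem_Icc _ (fun j => hN.meanWeight_mem_unitInterval t hz j _) _
  · simp

lemma integral_batchWeight (hN : N.IsModel P rate q)
    (hbatch : N.HasUnivariateBatches P (poissonMeasure μ) p) (t : ℝ) {z : Fin J → ℝ}
    (hz : ∀ k, z k ∈ Set.Icc (0 : ℝ) 1) (i : ℕ) (s : ℝ≥0∞) :
    ∫ ω, N.batchWeight q t z i (s, ω) ∂P =
      evalBefore t (fun τ => Real.exp (∑ k, batchMean μ p q t k τ * (z k - 1))) s := by
  unfold batchWeight evalBefore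
  simp only
  split_ifs
  · rw [integral_prod_pow_batch hbatch i fun j => hN.meanWeight_mem_unitInterval t hz j _,
      sum_mul_meanWeight hbatch.sum_eq_one]
  · simp

/-- First averaging: the routes are integrated out while arrival times and batch sizes, the sources
in `A`, stay frozen. -/
lemma integral_prod_customerWeight (hN : N.IsModel P rate q) (t : ℝ) {z : Fin J → ℝ}
    (hz : ∀ k, z k ∈ Set.Icc (0 : ℝ) 1) (s : Finset (CustomerIndex J)) :
    ∫ ω, ∏ c ∈ s, N.customerWeight t z c (N.entry c ω, ω) ∂P =
      ∫ ω, ∏ c ∈ s, (if (N.entry c ω).1 < ENNReal.ofReal t ∧ c.2.2 < (N.entry c ω).2 then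
        meanWeight q t z c.2.1 (N.entry c ω).1.toReal else 1) ∂P := by
  simp only [← hN.integral_customerWeight t z]
  refine integral_prod_eq_of_iIndep (src := CustomerIndex.source)
    (A := {σ | ∀ c : CustomerIndex J, σ ≠ c.source}) hN.sourceSigma_le hN.indep
    CustomerIndex.source_injective (fun c hc => hc c rfl) (fun c => ?_)
    (hN.measurable_customerWeight t z) (N.customerWeight_mem_unitInterval t hz) s
  have h1 : N.sourceSigma .arrivals ≤
      ⨆ σ ∈ {σ | ∀ c : CustomerIndex J, σ ≠ c.source}, N.sourceSigma σ :=
    le_iSup₂_of_le Source.arrivals (fun c h => by simp [CustomerIndex.source] at h) le_rfl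
  have h2 : N.sourceSigma (.batch c.1) ≤
      ⨆ σ ∈ {σ | ∀ c : CustomerIndex J, σ ≠ c.source}, N.sourceSigma σ :=
    le_iSup₂_of_le (Source.batch c.1) (fun c h => by simp [CustomerIndex.source] at h) le_rfl
  refine Measurable.prodMk ?_ ?_
  · exact measurable_iff_comap_le.2
      ((le_iSup (fun i => MeasurableSpace.comap (N.arrival i) inferInstance) c.1).trans h1)
  · exact (measurable_pi_apply c.2.1).comp (measurable_iff_comap_le.2 h2)

/-- Second averaging: the batch vectors are integrated out with only the arrival times frozen. -/
lemma integral_prod_batchWeight (hN : N.IsModel P rate q)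
    (hbatch : N.HasUnivariateBatches P (poissonMeasure μ) p) (t : ℝ) {z : Fin J → ℝ}
    (hz : ∀ k, z k ∈ Set.Icc (0 : ℝ) 1) (s : Finset ℕ) :
    ∫ ω, ∏ i ∈ s, N.batchWeight q t z i (N.arrival i ω, ω) ∂P =
      ∫ ω, ∏ i ∈ s, evalBefore t
        (fun τ => Real.exp (∑ k, batchMean μ p q t k τ * (z k - 1))) (N.arrival i ω) ∂P := by
  trans ∫ ω, ∏ i ∈ s, ∫ ω', N.batchWeight q t z i (N.arrival i ω, ω') ∂P ∂P
  swap
  · simp only [hN.integral_batchWeight hbatch t hz]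
  refine integral_prod_eq_of_iIndep (src := fun i => .batch i) (A := {.arrivals})
    hN.sourceSigma_le hN.indep (fun i i' h => by simpa using h)
    (fun i hi => by simp at hi) (fun i => ?_)
    (hN.measurable_batchWeight t z) (hN.batchWeight_mem_unitInterval t hz) s
  refine measurable_iff_comap_le.2 ?_
  refine (le_iSup (fun i => MeasurableSpace.comap (N.arrival i) inferInstance) i).trans ?_
  exact le_iSup₂_of_le (f := fun σ _ => N.sourceSigma σ) Source.arrivals rfl le_rfl

/-- The generating function of the vector of queue lengths at time `t`. -/
theorem integral_prod_pow_queueLengths (hN : N.IsModel P rate q)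
    (hbatch : N.HasUnivariateBatches P (poissonMeasure μ) p) (t : ℝ)
    [IsFiniteMeasure (intensity rate t)] {z : Fin J → ℝ} (hz : ∀ k, z k ∈ Set.Icc (0 : ℝ) 1) :
    ∫ ω, ∏ k, z k ^ N.queueLengths t ω k ∂P =
      Real.exp (-∫ τ, (1 - Real.exp (∑ k, batchMean μ p q t k τ * (z k - 1)))
        ∂(intensity rate t)) := by
  have hfin := hN.isPoissonProcess.ae_finite_setOf_lt (t := t)
  have harr := hN.isPoissonProcess.measurable_point
  set f : ℝ → ℝ := fun τ => Real.exp (∑ k, batchMean μ p q t k τ * (z k - 1)) with hf_def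
  have hf : Measurable f := Real.measurable_exp.comp (Finset.measurable_fun_sum _ fun k _ =>
    (hN.measurable_batchMean μ p t k).mul_const _)
  -- The value `f τ` is the expected weight of a batch that arrived at `τ`, hence lies in `[0, 1]`.
  have hf01 : ∀ τ, f τ ∈ Set.Icc (0 : ℝ) 1 := fun τ => by
    rw [hf_def]
    simp only
    rw [← sum_mul_meanWeight hbatch.sum_eq_one, ← integral_prod_pow_batch hbatch 0
      fun j => hN.meanWeight_mem_unitInterval t hz j _]
    have hm : ∀ j, meanWeight q t z j τ ∈ Set.Icc (0 : ℝ) 1 :=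
      fun j => hN.meanWeight_mem_unitInterval t hz j _
    refine integral_mem_unitInterval (Finset.measurable_fun_prod _ fun j _ => ?_)
      fun ω => prod_pow_mem_Icc _ hm _
    exact measurable_const.pow ((measurable_pi_apply j).comp (hN.measurable_batch 0))
  rw [← hN.isPoissonProcess.integral_finprod_evalBefore hf hf01]
  have hle : ∀ σ, (inferInstance : MeasurableSpace ℝ≥0∞).prod (N.sourceSigma σ) ≤
      (inferInstance : MeasurableSpace ℝ≥0∞).prod mΩ := fun σ =>
    sup_le_sup le_rfl (MeasurableSpace.comap_mono (hN.sourceSigma_le _))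
  have hcustomer := tendsto_integral_of_ae_eventually_eq (P := P)
    (f := fun m ω => ∏ c ∈ customerBox J m, N.customerWeight t z c (N.entry c ω, ω))
    (fun m => by
      classical
      exact Finset.measurable_fun_prod _ fun c _ => Finset.measurable_fun_prod _ fun k _ =>
        Measurable.ite (hN.measurableSet_entry_mem t c k) measurable_const measurable_const)
    (fun m ω => prod_mem_unitInterval fun c => N.customerWeight_mem_unitInterval t hz c _)
    (hfin.mono fun ω hω => N.eventually_prod_customerWeight z hω)
  have hmean := tendsto_integral_of_ae_eventually_eq (P := P)
    (f := fun m ω => ∏ c ∈ customerBox J m,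
      (if (N.entry c ω).1 < ENNReal.ofReal t ∧ c.2.2 < (N.entry c ω).2 then
        meanWeight q t z c.2.1 (N.entry c ω).1.toReal else 1))
    (g := fun ω => ∏ᶠ i, N.batchWeight q t z i (N.arrival i ω, ω))
    (fun m => Finset.measurable_fun_prod _ fun c _ => by
      have h1 := measurable_fst.comp (hN.measurable_entry c)
      have h2 := measurable_snd.comp (hN.measurable_entry c)
      exact Measurable.ite ((measurableSet_lt h1 measurable_const).inter
        (measurableSet_lt measurable_const h2))
        ((hN.measurable_meanWeight t z _).comp (ENNReal.measurable_toReal.comp h1))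
        measurable_const)
    (fun m ω => prod_mem_unitInterval fun c => by
      split_ifs
      · exact hN.meanWeight_mem_unitInterval t hz _ _
      · simp)
    (hfin.mono fun ω hω => by
      filter_upwards [N.eventually_prod_meanWeight q z hω, eventually_prod_range_eq_finprod
        (g := fun i => N.batchWeight q t z i (N.arrival i ω, ω)) hω
        fun i hi => by rw [batchWeight, if_neg hi]] with m h1 h2
      rw [h1, h2])
  have hbatchWeight := tendsto_integral_of_ae_eventually_eq (P := P)
    (f := fun m ω => ∏ i ∈ Finset.range m, N.batchWeight q t z i (N.arrival i ω, ω))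
    (g := fun ω => ∏ᶠ i, N.batchWeight q t z i (N.arrival i ω, ω))
    (fun m => Finset.measurable_fun_prod _ fun i _ =>
      ((hN.measurable_batchWeight t z i).mono (hle _) le_rfl).comp
        ((harr i).prodMk measurable_id))
    (fun m ω => prod_mem_unitInterval fun i => hN.batchWeight_mem_unitInterval t hz i _)
    (hfin.mono fun ω hω => eventually_prod_range_eq_finprod hω
      fun i hi => by rw [batchWeight, if_neg hi])
  have heval := tendsto_integral_of_ae_eventually_eq (P := P)
    (f := fun m ω => ∏ i ∈ Finset.range m, evalBefore t f (N.arrival i ω))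
    (fun m => Finset.measurable_fun_prod _ fun i _ => (measurable_evalBefore t hf).comp (harr i))
    (fun m ω => prod_mem_unitInterval fun i => evalBefore_mem_unitInterval hf01 _)
    (hfin.mono fun ω hω => eventually_prod_range_evalBefore f hω)
  simp only [hN.integral_prod_customerWeight t hz] at hcustomer
  simp only [hN.integral_prod_batchWeight hbatch t hz] at hbatchWeight
  -- After the rewriting, `hcustomer` and `hmean` are limits of one sequence, and so are
  -- `hbatchWeight` and `heval`; the limits of `hmean` and `hbatchWeight` coincide.
  exact (tendsto_nhds_unique hcustomer hmean).trans (tendsto_nhds_unique hbatchWeight heval)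

lemma summable_occupancyProb (hN : N.IsModel P rate q) (t : ℝ)
    [IsFiniteMeasure (intensity rate t)] : Summable (N.occupancyProb P t) := by
  have := Measure.isProbabilityMeasure_map (μ := P) (hN.aemeasurable_queueLengths t)
  have h1 : ∑' n, (P.map (N.queueLengths t)) {n} ≠ ⊤ := by
    rw [← measure_iUnion (fun i j hij => by simpa using hij) fun n => measurableSet_singleton n]
    exact measure_ne_top _ _
  exact (ENNReal.summable_toReal h1).congr fun n => (hN.occupancyProb_eq_map t n).symm

lemma tsum_occupancyProb_mul_monomial (hN : N.IsModel P rate q) (t : ℝ)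
    [IsFiniteMeasure (intensity rate t)] {z : Fin J → ℝ} (hz : ∀ k, z k ∈ Set.Icc (0 : ℝ) 1) :
    ∑' n, N.occupancyProb P t n * ∏ k, z k ^ n k =
      ∫ ω, ∏ k, z k ^ N.queueLengths t ω k ∂P := by
  have := Measure.isProbabilityMeasure_map (μ := P) (hN.aemeasurable_queueLengths t)
  have h1 : ∫ ω, ∏ k, z k ^ N.queueLengths t ω k ∂P =
      ∫ n, ∏ k, z k ^ n k ∂(P.map (N.queueLengths t)) :=
    (integral_map (f := fun n : Fin J → ℕ => ∏ k, z k ^ n k) (hN.aemeasurable_queueLengths t)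
      (Measurable.of_discrete).aestronglyMeasurable).symm
  rw [h1, integral_countable (integrable_of_mem_unitInterval
    (Measurable.of_discrete).aestronglyMeasurable fun n => prod_pow_mem_Icc _ hz n)]
  refine tsum_congr fun n => ?_
  rw [hN.occupancyProb_eq_map, smul_eq_mul]

theorem occupancyProb_recurrence (hN : N.IsModel P rate q)
    (hbatch : N.HasUnivariateBatches P (poissonMeasure μ) p) (t : ℝ)
    [IsFiniteMeasure (intensity rate t)] (v : Fin J) (n : Fin J → ℕ) :
    n v * N.occupancyProb P t n = ∑ i ∈ Finset.Icc 0 n,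
      i v * (∫ τ, poissonProd (fun k => batchMean μ p q t k τ) i ∂(intensity rate t)) *
        N.occupancyProb P t (n - i) := by
  refine recurrence_of_pgf_eq (hN.summable_occupancyProb t) (hN.measurable_batchMean μ p t)
    (fun k τ => ?_) (fun z hz => ?_) v n
  · exact mul_nonneg μ.2 (Finset.sum_nonneg fun j _ =>
      mul_nonneg (hbatch.nonneg j) (hN.location_prob_nonneg (le_max_left _ _) j k))
  · have hz' : ∀ k, z k ∈ Set.Icc (0 : ℝ) 1 := fun k => Set.Ioo_subset_Icc_self (hz k)
    rw [hN.tsum_occupancyProb_mul_monomial t hz', hN.integral_prod_pow_queueLengths hbatch t hz']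

end IsModel

end BatchNetwork

/-! ### The recurrence -/

section Intensity

variable {rate : ℝ → ℝ} {t : ℝ}

lemma integrableOn_Ico_of_intervalIntegrable (ht : 0 ≤ t)
    (h : IntervalIntegrable rate volume 0 t) : IntegrableOn rate (Set.Ico 0 t) :=
  ((intervalIntegrable_iff_integrableOn_Icc_of_le ht).1 h).mono_set Set.Ico_subset_Icc_self

lemma isFiniteMeasure_intensity (ht : 0 ≤ t) (h : IntervalIntegrable rate volume 0 t) :
    IsFiniteMeasure (intensity rate t) :=
  isFiniteMeasure_withDensity_ofReal (integrableOn_Ico_of_intervalIntegrable ht h).2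

lemma integral_intensity (ht : 0 ≤ t) (h : IntervalIntegrable rate volume 0 t)
    (h0 : ∀ s, 0 ≤ s → 0 ≤ rate s) (f : ℝ → ℝ) :
    ∫ τ, f τ ∂(intensity rate t) = ∫ τ in (0 : ℝ)..t, rate τ * f τ := by
  rw [intensity, integral_withDensity_eq_integral_toReal_smul₀
    (integrableOn_Ico_of_intervalIntegrable ht h).1.aemeasurable.ennreal_ofReal
    (.of_forall fun _ => ENNReal.ofReal_lt_top), intervalIntegral.integral_of_le ht,
    ← integral_Ico_eq_integral_Ioc]
  refine setIntegral_congr_fun measurableSet_Ico fun τ hτ => ?_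
  rw [ENNReal.toReal_ofReal (h0 τ hτ.1), smul_eq_mul]

end Intensity

lemma prod_Iic_pow_mul_exp_eq_poissonProd {J : ℕ} (x : Fin J → ℝ) (v : Fin J) {i : Fin J → ℕ}
    (hi : ∀ k, v < k → i k = 0) :
    (∏ k ∈ Finset.Iic v, x k ^ i k / (i k).factorial) * Real.exp (-∑ k, x k) = poissonProd x i := by
  rw [poissonProd]
  congr 1
  refine Finset.prod_subset (Finset.subset_univ _) fun k _ hk => ?_
  rw [hi k (not_le.1 fun h => hk (Finset.mem_Iic.2 h))]
  simp

/-- The kernel only sees `i k` for `k ≤ v`, so it is the Poisson mass at `i` with the later entries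
set to zero. This form covers every `i`, as the existence of the integrals requires. -/
lemma recurrence_kernel_eq {J : ℕ} (μ : ℝ≥0) (p : Fin J → ℝ) (q : Fin J → Fin J → ℝ → ℝ)
    {t τ : ℝ} (hτ : τ ≤ t) (v : Fin J) (i : Fin J → ℕ) :
    (∏ k ∈ Finset.Iic v, (mixedLocation p q k (t - τ) * μ) ^ i k / (i k).factorial) *
        Real.exp (-(μ * ∑ k, mixedLocation p q k (t - τ))) =
      poissonProd (fun k => BatchNetwork.batchMean μ p q t k τ)
        (fun k => if v < k then 0 else i k) := by
  rw [← prod_Iic_pow_mul_exp_eq_poissonProd _ v fun k hk => if_pos hk]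
  simp only [BatchNetwork.batchMean, max_eq_right (sub_nonneg.2 hτ), ← Finset.mul_sum]
  congr 1
  refine Finset.prod_congr rfl fun k hk => ?_
  rw [if_neg (not_lt.2 (Finset.mem_Iic.1 hk)), mul_comm (μ : ℝ)]

theorem corollary5p3 {Ω : Type*} [MeasurableSpace Ω] (P : Measure Ω) [IsProbabilityMeasure P]
    {J : ℕ} (N : BatchNetwork Ω J) (rate : ℝ → ℝ) (q : Fin J → Fin J → ℝ → ℝ)
    (p : Fin J → ℝ) (μ : ℝ≥0)
    (hrate_nonneg : ∀ s, 0 ≤ s → 0 ≤ rate s)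
    (hrate : ∀ s, 0 ≤ s → IntervalIntegrable rate volume 0 s)
    (hN : N.IsModel P rate q)
    (hbatch : N.HasUnivariateBatches P (poissonMeasure μ) p)
    (t : ℝ) (ht : 0 ≤ t) (v : Fin J) (n : Fin J → ℕ) (hnv : 1 ≤ n v)
    (hn : ∀ k, v < k → n k = 0) :
    -- the integrals that occur in the recurrence exist
    (∀ i : Fin J → ℕ, IntervalIntegrable
      (fun τ => rate τ
        * (∏ k ∈ Finset.Iic v, (mixedLocation p q k (t - τ) * μ) ^ i k / (i k).factorial)
        * Real.exp (-(μ * ∑ k, mixedLocation p q k (t - τ)))) volume 0 t) ∧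
    -- the recurrence; the index `i` runs over `0 ≤ i k ≤ n k` with `1 ≤ i v`
    N.occupancyProb P t n =
      ∑ i ∈ Finset.Icc (Pi.single v 1) n,
        (i v : ℝ) / n v * N.occupancyProb P t (n - i) *
          ∫ τ in (0 : ℝ)..t, rate τ
            * (∏ k ∈ Finset.Iic v, (mixedLocation p q k (t - τ) * μ) ^ i k / (i k).factorial)
            * Real.exp (-(μ * ∑ k, mixedLocation p q k (t - τ))) ∧
    -- the kernel when no customer leaves the network
    ((∀ s, 0 ≤ s → s ≤ t → ∑ k, mixedLocation p q k s = 1) →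
      N.occupancyProb P t n =
        ∑ i ∈ Finset.Icc (Pi.single v 1) n,
          (i v : ℝ) / n v * N.occupancyProb P t (n - i) *
            ∫ τ in (0 : ℝ)..t, rate τ
              * (∏ k ∈ Finset.Iic v, (mixedLocation p q k (t - τ) * μ) ^ i k / (i k).factorial)
              * Real.exp (-μ)) := by
  have hfin := isFiniteMeasure_intensity ht (hrate t ht)
  have hmean0 : ∀ k τ, 0 ≤ BatchNetwork.batchMean μ p q t k τ := fun k τ =>
    mul_nonneg μ.2 (Finset.sum_nonneg fun j _ =>
      mul_nonneg (hbatch.nonneg j) (hN.location_prob_nonneg (le_max_left _ _) j k))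
  have hrec : N.occupancyProb P t n =
      ∑ i ∈ Finset.Icc (Pi.single v 1) n,
        (i v : ℝ) / n v * N.occupancyProb P t (n - i) *
          ∫ τ in (0 : ℝ)..t, rate τ
            * (∏ k ∈ Finset.Iic v, (mixedLocation p q k (t - τ) * μ) ^ i k / (i k).factorial)
            * Real.exp (-(μ * ∑ k, mixedLocation p q k (t - τ))) := by
    have hnv' : (n v : ℝ) ≠ 0 := by exact_mod_cast (by omega : n v ≠ 0)
    have h := hN.occupancyProb_recurrence hbatch t v n
    rw [mul_comm, ← eq_div_iff hnv'] at h
    rw [h, Finset.sum_div]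
    have hsub : Finset.Icc (Pi.single v 1) n ⊆ Finset.Icc 0 n :=
      Finset.Icc_subset_Icc_left zero_le
    -- The indices lost in passing to the smaller box are those with `i v = 0`, whose terms carry
    -- the factor `i v`.
    rw [← Finset.sum_subset hsub fun i hi hi' => ?_]
    · refine Finset.sum_congr rfl fun i hi => ?_
      have hi0 : ∀ k, v < k → i k = 0 := fun k hk =>
        Nat.le_zero.1 (((Finset.mem_Icc.1 hi).2 k).trans_eq (hn k hk))
      rw [integral_intensity ht (hrate t ht) hrate_nonneg]
      have : ∫ τ in (0 : ℝ)..t, rate τ * poissonProd (fun k => BatchNetwork.batchMean μ p q t k τ) i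
          = ∫ τ in (0 : ℝ)..t, rate τ
            * (∏ k ∈ Finset.Iic v, (mixedLocation p q k (t - τ) * μ) ^ i k / (i k).factorial)
            * Real.exp (-(μ * ∑ k, mixedLocation p q k (t - τ))) := by
        refine intervalIntegral.integral_congr fun τ hτ => ?_
        rw [Set.uIcc_of_le ht] at hτ
        rw [mul_assoc, recurrence_kernel_eq μ p q hτ.2]
        congr 2
        funext k
        split_ifs with hk
        · exact hi0 k hk
        · rfl
      rw [this]
      ring
    · have : i v = 0 := by
        by_contra hiv
        refine hi' (Finset.mem_Icc.2 ⟨fun k => ?_, (Finset.mem_Icc.1 hi).2⟩)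
        rcases eq_or_ne k v with rfl | hk
        · rw [Pi.single_eq_same]; exact Nat.one_le_iff_ne_zero.2 hiv
        · rw [Pi.single_eq_of_ne hk]; exact zero_le
      simp [this]
  refine ⟨fun i => ?_, hrec, fun hsum => ?_⟩
  -- The kernel is a probability mass, hence at most `1`, and multiplies an integrable rate.
  · have hbdd : IntervalIntegrable (fun τ => poissonProd
        (fun k => BatchNetwork.batchMean μ p q t k τ) (fun k => if v < k then 0 else i k) * rate τ)
        volume 0 t := by
      rw [intervalIntegrable_iff_integrableOn_Ioc_of_le ht]
      refine Integrable.bdd_mul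
        ((intervalIntegrable_iff_integrableOn_Ioc_of_le ht).1 (hrate t ht))
        (measurable_poissonProd (hN.measurable_batchMean μ p t) _).aestronglyMeasurable
        (c := 1) (.of_forall fun τ => ?_)
      rw [Real.norm_eq_abs, abs_of_nonneg (poissonProd_nonneg (fun k => hmean0 k τ) _)]
      exact poissonProd_le_one (fun k => hmean0 k τ) _
    refine hbdd.congr fun τ hτ => ?_
    rw [Set.uIoc_of_le ht] at hτ
    rw [mul_assoc, recurrence_kernel_eq μ p q hτ.2, mul_comm]
  · rw [hrec]
    refine Finset.sum_congr rfl fun i _ => ?_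
    congr 1
    refine intervalIntegral.integral_congr fun τ hτ => ?_
    rw [Set.uIcc_of_le ht] at hτ
    rw [hsum (t - τ) (by linarith [hτ.2]) (by linarith [hτ.1]), mul_one]
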